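/- All posets are finite. Let $\mathcal{P}$ be a bounded poset with least element $\hat 0$ and greatest element $\hat 1$, and write $p\lessdot q$ if $q$ covers $p$. For $m>0$ let the *$m$-cover poset* $\mathcal{P}^{\langle m\rangle}$ be the set of all $m$-tuples $(\hat0^{\,l_0},p^{\,l_1},q^{\,l_2})$ (that is, $l_0$ entries $\hat 0$, then $l_1$ entries $p$, then $l_2$ entries $q$) with $p\lessdot q$ in $\mathcal{P}$, $l_0,l_1,l_2\ge 0$ and $l_0+l_1+l_2=m$, together with the constant tuple $(\hat 0^{\,m})$, ordered componentwise. For $k,l\ge 0$ let $\mathcal{P}_{k,l}$ be the bounded poset whose proper part (the poset without $\hat 0,\hat 1$) is the disjoint union of a $k$-element chain and an $l$-element antichain. Let $\mathfrak{p}$ be a northeast path, given by a word $w_1\cdots w_n$ $(n\ge 0)$ in the letters $N,E$. The *path order* $\le_{\mathfrak p}$ on $\{w_1,\dots,w_n\}$ is the reflexive transitive closure of the following relations: each $w_i=N$ is below the next occurrence $w_j=N$, and each $w_j=E$ is below the letter $N$ immediately preceding the maximal block of consecutive letters $E$ that contains $w_j$ (if there is such an $N$). The *path poset* $\mathcal{P}_{k,l;\mathfrak{p}}$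 is the disjoint union of $\mathcal{P}_{k,l}$ and $\{w_1,\dots,w_n\}$ with $x\le y$ if and only if one of the following holds: $x,y\in\mathcal{P}_{k,l}$ and $x\le y$ there; $x,y\notin\mathcal{P}_{k,l}$ and $x\le_{\mathfrak p}y$; $x=\hat 0\in\mathcal{P}_{k,l}$ and $y=w_j=E$ for some $j$; $x\in\mathcal{P}_{k,l}$ and $y=w_j=N$ for some $j$. A poset is *$(\mathbf{2+2})$-free* if it does not contain elements $x<y$ and $x'<y'$ such that each of $x,y$ is incomparable to each of $x',y'$. An element $p$ of a lattice is *left-modular* if $(q\vee p)\wedge q'=q\vee(p\wedge q')$ for all $q<q'$. A lattice is *left-modular* if it has a saturated maximal chain $\hat 0=p_1\lessdot\cdots\lessdot p_s=\hat 1$ of left-modular elements. A bounded poset is *EL-shellable* if its cover relations can be labeled by elements of some poset such that every interval has a unique saturated maximal chain with strictly increasing label sequence, and the label sequence of this chain lexicographically precedes those of all other saturated maximal chains of the interval. **Theorem.** Let $\mathcal{P}$ be a finite bounded poset such that $\mathcal{P}^{\langle m\rangle}$ is a lattice for all $m>0$. Then for every $m>0$ the following are equivalent: (a) $\mathcal{P}$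 is a singleton, or $\mathcal{P}\cong\mathcal{P}_{k,l;\mathfrak{p}}$ for some $k,l\ge 0$ and some northeast path $\mathfrak{p}$; (b) $\mathcal{P}$ is $(\mathbf{2+2})$-free; (c) $\mathcal{P}^{\langle m\rangle}$ is left-modular; (d) $\mathcal{P}^{\langle m\rangle}$ is EL-shellable. -/

import Mathlib

namespace CoverPoset

/-! ### Lattices, saturated chains, left-modularity -/

/-- The poset `P` is a lattice: any two elements have a join and a meet. -/
def IsLatticePoset (P : Type*) [PartialOrder P] : Prop :=
  ∀ p q : P, (∃ j, IsLUB {p, q} j) ∧ (∃ i, IsGLB {p, q} i)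

/-- The (unique) lattice structure on a poset that is a lattice; the order is the given one. -/
@[reducible] noncomputable def IsLatticePoset.toLattice {P : Type*} [inst : PartialOrder P]
    (h : IsLatticePoset P) : Lattice P :=
  { inst with
    sup := fun p q => (h p q).1.choose
    le_sup_left := fun p q => (h p q).1.choose_spec.1 (by simp)
    le_sup_right := fun p q => (h p q).1.choose_spec.1 (by simp)
    sup_le := fun p q r hp hq => (h p q).1.choose_spec.2 (by
      rintro x (rfl | rfl)
      · exact hp
      · exact hq)
    inf := fun p q => (h p q).2.choose
    inf_le_left := fun p q => (h p q).2.choose_spec.1 (by simp)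
    inf_le_right := fun p q => (h p q).2.choose_spec.1 (by simp)
    le_inf := fun r p q hp hq => (h p q).2.choose_spec.2 (by
      rintro x (rfl | rfl)
      · exact hp
      · exact hq) }

/-- `c` lists a saturated maximal chain `x = c₁ ⋖ c₂ ⋖ ⋯ ⋖ cₛ = y` of the interval `[x, y]`. -/
def IsSaturatedChain {P : Type*} [PartialOrder P] (x y : P) (c : List P) : Prop :=
  c.IsChain (· ⋖ ·) ∧ c.head? = some x ∧ c.getLast? = some y

/-- The element `p` of a lattice is left-modular. -/
def IsLeftModularElem {L : Type*} [Lattice L] (p : L) : Prop :=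
  ∀ q q' : L, q < q' → (q ⊔ p) ⊓ q' = q ⊔ (p ⊓ q')

/-- The poset `P` is a left-modular lattice: it is a lattice, and some saturated maximal chain,
from the least to the greatest element, consists of left-modular elements. -/
def IsLeftModularLattice (P : Type*) [PartialOrder P] : Prop :=
  ∃ h : IsLatticePoset P, letI := h.toLattice
    ∃ (bot top : P) (c : List P), IsBot bot ∧ IsTop top ∧ IsSaturatedChain bot top c ∧
      ∀ p ∈ c, IsLeftModularElem p

/-! ### EL-shellability -/

/-- The sequence of labels of the consecutive edges of the chain `c`. -/
def edgeLabels {P Λ : Type*} (lab : P → P → Λ) (c : List P) : List Λ :=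
  List.zipWith lab c c.tail

/-- The sequence of edge labels of the chain `c` is strictly increasing. -/
def IsRising {P Λ : Type*} [PartialOrder Λ] (lab : P → P → Λ) (c : List P) : Prop :=
  (edgeLabels lab c).IsChain (· < ·)

/-- `lab` is an EL-labeling of `P`, where `lab p q` is the label of the edge `p ⋖ q` (the other
values of `lab` are never used): every interval `[x, y]` has a unique rising saturated maximal
chain, and its label sequence lexicographically precedes that of every other saturated maximal
chain of the interval. -/
def IsELLabeling {P Λ : Type*} [PartialOrder P] [PartialOrder Λ] (lab : P → P → Λ) : Prop :=
  ∀ x y : P, x ≤ y →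
    ∃ c : List P, IsSaturatedChain x y c ∧ IsRising lab c ∧
      (∀ d : List P, IsSaturatedChain x y d → IsRising lab d → d = c) ∧
      (∀ d : List P, IsSaturatedChain x y d → d ≠ c →
        List.Lex (· < ·) (edgeLabels lab c) (edgeLabels lab d))

/-- The poset `P` is bounded and admits an EL-labeling with labels in some poset. For finite `P`,
as considered here, only finitely many labels occur, so it suffices to let the poset of labels
range over `Type`. -/
def IsELShellable (P : Type*) [PartialOrder P] : Prop :=
  (∃ x : P, IsBot x) ∧ (∃ y : P, IsTop y) ∧
    ∃ (Λ : Type) (_ : PartialOrder Λ) (lab : P → P → Λ), IsELLabeling lab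

/-! ### Posets without a `2+2` -/

/-- The poset `P` is `(2+2)`-free. -/
def IsTwoPlusTwoFree (P : Type*) [PartialOrder P] : Prop :=
  ¬ ∃ x y x' y' : P, x < y ∧ x' < y' ∧
    (¬ x ≤ x' ∧ ¬ x ≤ y' ∧ ¬ y ≤ x' ∧ ¬ y ≤ y') ∧
    (¬ x' ≤ x ∧ ¬ x' ≤ y ∧ ¬ y' ≤ x ∧ ¬ y' ≤ y)

/-! ### The `m`-cover poset -/

/-- The tuple `(⊥, …, ⊥, p, …, p, q, …, q)` of length `m` with `l₀` entries `⊥`, then `l₁`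
entries `p`, and the remaining entries equal to `q`. -/
def mTuple {P : Type*} [PartialOrder P] [BoundedOrder P] (m l₀ l₁ : ℕ) (p q : P) : Fin m → P :=
  fun i => if (i : ℕ) < l₀ then ⊥ else if (i : ℕ) < l₀ + l₁ then p else q

/-- The `m`-cover poset of a bounded poset `P`: all `m`-tuples `(⊥^l₀, p^l₁, q^l₂)` with `p ⋖ q`
and `l₀ + l₁ + l₂ = m`, ordered componentwise. The constant tuple `⊥` is of this form as soon as
`P` has two elements; it is listed separately for the sake of the one-element poset. -/
abbrev MCover (P : Type*) [PartialOrder P] [BoundedOrder P] (m : ℕ) : Type _ :=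
  {x : Fin m → P // x = ⊥ ∨
    ∃ p q : P, p ⋖ q ∧ ∃ l₀ l₁ l₂ : ℕ, l₀ + l₁ + l₂ = m ∧ x = mTuple m l₀ l₁ p q}

/-! ### Northeast paths and path posets -/

/-- The two kinds of steps of a northeast path. -/
inductive NEStep where
  | north : NEStep
  | east : NEStep

/-- A northeast path, encoded by its word in the letters north and east. -/
abbrev NEPath : Type := List NEStep

/-- For a position `j` (counted from `0`) carrying an east-step, the position at which the maximal
block of consecutive east-steps around `j` starts. -/
def NEPath.blockStart (w : NEPath) : ℕ → ℕ
  | 0 => 0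
  | j + 1 =>
    match w[j]? with
    | some NEStep.east => NEPath.blockStart w j
    | _ => j + 1

/-- The relation generating the path order: a north-step is covered by the next north-step, and
an east-step is covered by the north-step immediately before its block of east-steps, if any. -/
inductive NEPath.StepCov (w : NEPath) : Fin w.length → Fin w.length → Prop
  | north {i j : Fin w.length} (hij : i < j) (hi : w.get i = NEStep.north)
      (hj : w.get j = NEStep.north)
      (hs : ∀ s, i < s → s < j → w.get s ≠ NEStep.north) : NEPath.StepCov w i j
  | east {j i : Fin w.length} (hj : w.get j = NEStep.east) (hi : w.get i = NEStep.north)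
      (h : NEPath.blockStart w j = i + 1) : NEPath.StepCov w j i

/-- The path order on the (positions of the) letters of `w`. -/
def NEPath.StepLE (w : NEPath) : Fin w.length → Fin w.length → Prop :=
  Relation.ReflTransGen (NEPath.StepCov w)

/-- The ground set of the path poset of `P` and `w`: the disjoint union of `P` and the letters
of `w`. -/
inductive PathPoset (P : Type*) (w : NEPath) where
  | base (p : P) : PathPoset P w
  | step (j : Fin w.length) : PathPoset P w

/-- The order of the path poset. -/
def PathPoset.le {P : Type*} [PartialOrder P] [BoundedOrder P] {w : NEPath} :
    PathPoset P w → PathPoset P w → Prop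
  | .base p, .base q => p ≤ q
  | .step i, .step j => NEPath.StepLE w i j
  | .base p, .step j =>
      (p = ⊥ ∧ w.get j = NEStep.east) ∨ w.get j = NEStep.north
  | .step _, .base _ => False

/-- Auxiliary rank function, used for antisymmetry of the path order. -/
def NEPath.rank (w : NEPath) (i : Fin w.length) : ℕ :=
  match w.get i with
  | .north => i + 1
  | .east => 0

theorem NEPath.StepCov.rank_lt {w : NEPath} {i j : Fin w.length} (h : NEPath.StepCov w i j) :
    w.rank i < w.rank j := by
  cases h with
  | north hij hi hj _ => simp only [NEPath.rank, hi, hj]; omega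
  | east hj hi _ => simp only [NEPath.rank, hi, hj]; omega

theorem NEPath.StepLE.eq_or_rank_lt {w : NEPath} {i j : Fin w.length}
    (h : NEPath.StepLE w i j) : i = j ∨ w.rank i < w.rank j := by
  unfold NEPath.StepLE at h
  induction h with
  | refl => exact Or.inl rfl
  | tail _ hc ih =>
    rcases ih with rfl | ih
    · exact Or.inr hc.rank_lt
    · exact Or.inr (ih.trans hc.rank_lt)

theorem NEPath.StepLE.north {w : NEPath} {i j : Fin w.length} (h : NEPath.StepLE w i j) :
    i = j ∨ w.get j = NEStep.north := by
  unfold NEPath.StepLE at h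
  cases h with
  | refl => exact Or.inl rfl
  | tail _ hc =>
    cases hc with
    | north _ _ hj _ => exact Or.inr hj
    | east _ hi _ => exact Or.inr hi

instance {P : Type*} [PartialOrder P] [BoundedOrder P] (w : NEPath) :
    PartialOrder (PathPoset P w) where
  le := PathPoset.le
  le_refl x := by
    cases x with
    | base p => exact le_refl p
    | step j => exact Relation.ReflTransGen.refl
  le_trans x y z hxy hyz := by
    cases x <;> cases y <;> cases z <;> simp only [PathPoset.le] at hxy hyz ⊢
    · exact le_trans hxy hyz
    · rcases hyz with ⟨rfl, h⟩ | h
      · exact Or.inl ⟨le_bot_iff.mp hxy, h⟩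
      · exact Or.inr h
    · rcases hyz.north with rfl | h
      · exact hxy
      · exact Or.inr h
    · exact Relation.ReflTransGen.trans hxy hyz
  le_antisymm x y hxy hyx := by
    cases x <;> cases y <;> simp only [PathPoset.le] at hxy hyx
    · rw [le_antisymm hxy hyx]
    · rcases hxy.eq_or_rank_lt with rfl | h
      · rfl
      · rcases hyx.eq_or_rank_lt with rfl | h'
        · rfl
        · omega

/-! ### The posets `P_{k,l}` -/

/-- The antichain with `l` elements. -/
structure AntichainPoset (l : ℕ) where
  /-- the index of an element -/
  idx : Fin l

instance (l : ℕ) : PartialOrder (AntichainPoset l) where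
  le a b := a = b
  le_refl _ := rfl
  le_trans _ _ _ h h' := h.trans h'
  le_antisymm _ _ h _ := h

/-- The bounded poset whose proper part is the disjoint union of a `k`-chain and an `l`-antichain
(`⊕` carries the order in which elements of different summands are incomparable). -/
abbrev ChainAntichain (k l : ℕ) : Type := WithBot (WithTop (Fin k ⊕ AntichainPoset l))

end CoverPoset

namespace CoverPoset

/-! ### Saturated chains -/

section Chains

variable {P : Type*} {x y z : P} {c : List P}

/-! The lattice property for `m = 2` already makes `P` without `⊥` a tree rooted at `⊤`
(`eq_of_covBy_of_mCover_two`): the elements above a nonzero element form a chain. In such a poset,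
being `2+2`-free means exactly that the high elements, those strictly above some nonzero element,
form a chain (`IsTreeLike.isTwoPlusTwoFree_iff`). Everything is played off against this chain.

If the high elements form a chain, some atom `a` lies below all of them. Then `⊥`, `a` form the base
of a path poset, the high elements are its letters `N`, and the remaining atoms are its letters `E`,
each placed after the least high element above it (`nonempty_orderIso_pathPoset`); so `k = l = 0`
suffices. Conversely, in any path poset the elements strictly above a non-least element form a
chain.

Climbing from `⊥` through `a` to `⊤` and raising one entry at a time gives a maximal chain of
left-modular elements of the cover poset (`isLeftModularElem_mCover`). A left-modular chain induces
an EL-labeling (`isELLabeling_seqLabel`). Finally, `P` sits in the cover poset as a lower set, so an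
EL-labeling restricts to `P`; there, uniqueness of the rising maximal chain puts all high elements
on that chain (`IsELLabeling.isTwoPlusTwoFree`). -/

theorem edgeLabels_cons_cons {Λ : Type*} (lab : P → P → Λ) (x y : P) (c : List P) :
    edgeLabels lab (x :: y :: c) = lab x y :: edgeLabels lab (y :: c) := rfl

theorem isRising_of_forall_lt {Λ : Type*} [PartialOrder Λ] {lab : P → P → Λ}
    (hc : IsRising lab (y :: c)) (h : ∀ z c', c = z :: c' → lab x y < lab y z) :
    IsRising lab (x :: y :: c) := by
  cases c with
  | nil => simp [IsRising, edgeLabels]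
  | cons z c' => exact List.isChain_cons_cons.2 ⟨h z c' rfl, hc⟩

theorem IsRising.tail {Λ : Type*} [PartialOrder Λ] {lab : P → P → Λ}
    (h : IsRising lab (x :: y :: c)) : IsRising lab (y :: c) := by
  unfold IsRising at h ⊢
  rw [edgeLabels_cons_cons] at h
  exact h.of_cons

variable [PartialOrder P]

theorem IsSaturatedChain.singleton (x : P) : IsSaturatedChain x x [x] := by
  simp [IsSaturatedChain]

theorem IsSaturatedChain.exists_eq_cons (h : IsSaturatedChain x y c) : ∃ c', c = x :: c' := by
  cases c with
  | nil => simp [IsSaturatedChain] at h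
  | cons a c' => exact ⟨c', by have := h.2.1; simp_all⟩

theorem IsSaturatedChain.cons (hxy : x ⋖ y) (h : IsSaturatedChain y z c) :
    IsSaturatedChain x z (x :: c) := by
  obtain ⟨c', rfl⟩ := h.exists_eq_cons
  exact ⟨List.isChain_cons_cons.2 ⟨hxy, h.1⟩, rfl, by simpa using h.2.2⟩

theorem IsSaturatedChain.cases (h : IsSaturatedChain x z c) :
    (x = z ∧ c = [x]) ∨ ∃ y c', x ⋖ y ∧ c = x :: y :: c' ∧ IsSaturatedChain y z (y :: c') := by
  obtain ⟨c', rfl⟩ := h.exists_eq_cons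
  cases c' with
  | nil => exact Or.inl ⟨by simpa using h.2.2, rfl⟩
  | cons y c'' =>
    have h1 := List.isChain_cons_cons.1 h.1
    exact Or.inr ⟨y, c'', h1.1, rfl, h1.2, rfl, by simpa using h.2.2⟩

theorem IsSaturatedChain.induction {motive : P → List P → Prop} (base : motive z [z])
    (step : ∀ x y c, x ⋖ y → IsSaturatedChain y z (y :: c) → motive y (y :: c) →
      motive x (x :: y :: c)) (h : IsSaturatedChain x z c) : motive x c := by
  induction c generalizing x with
  | nil => simp [IsSaturatedChain] at h
  | cons a c ih =>
    rcases h.cases with ⟨rfl, h'⟩ | ⟨y, c', hxy, h', hc'⟩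
    · rw [h']; exact base
    · obtain ⟨rfl, rfl⟩ := List.cons.inj h'
      exact step _ _ _ hxy hc' (ih hc')

theorem IsSaturatedChain.le (h : IsSaturatedChain x z c) : x ≤ z :=
  h.induction (motive := fun x _ => x ≤ z) le_rfl fun _ _ _ hxy _ ih => hxy.le.trans ih

theorem IsSaturatedChain.eq_singleton (h : IsSaturatedChain x x c) : c = [x] := by
  rcases h.cases with ⟨_, h'⟩ | ⟨y, c', hxy, _, hc'⟩
  · exact h'
  · exact absurd hc'.le hxy.lt.not_ge

end Chains

/-! ### Left-modular lattices are EL-shellable -/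

/-- A labeling is an EL-labeling as soon as every nontrivial interval has a first atom which
dominates all other choices. -/
theorem isELLabeling_of_first_atom {P Λ : Type*} [PartialOrder P] [Finite P] [PartialOrder Λ]
    {lab : P → P → Λ}
    (H : ∀ y z : P, y < z → ∃ u, y ⋖ u ∧ u ≤ z ∧
      (∀ v v', u ≤ v → v ⋖ v' → v' ≤ z → lab y u < lab v v') ∧
      (∀ u', y ⋖ u' → u' ≤ z → u' ≠ u → lab y u < lab y u') ∧
      (∀ u' c, y ⋖ u' → u' ≠ u → IsSaturatedChain y z (y :: u' :: c) →
        ¬ IsRising lab (y :: u' :: c))) :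
    IsELLabeling lab := by
  intro y z hyz
  induction y using WellFoundedGT.induction with
  | ind y ih =>
    rcases hyz.eq_or_lt with rfl | hlt
    · exact ⟨[y], .singleton y, by simp [IsRising, edgeLabels], fun d hd _ => hd.eq_singleton,
        fun d hd h => absurd hd.eq_singleton h⟩
    obtain ⟨u, hyu, huz, h1, h2, h3⟩ := H y z hlt
    obtain ⟨c, hc, hr, huniq, hlex⟩ := ih u hyu.lt huz
    obtain ⟨c', rfl⟩ := hc.exists_eq_cons
    -- The rising chain of `[u, z]` with `y` prepended: it is rising because the first label lies
    -- below every label in `[u, z]`.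
    refine ⟨y :: u :: c', hc.cons hyu, ?_, ?_, ?_⟩
    · refine isRising_of_forall_lt hr ?_
      rintro v c'' rfl
      rcases hc.cases with ⟨_, h⟩ | ⟨v', c3, hv, h, hs⟩
      · simp at h
      · simp only [List.cons.injEq, true_and] at h
        obtain ⟨rfl, rfl⟩ := h
        exact h1 _ _ le_rfl hv hs.le
    · intro d hd hdr
      rcases hd.cases with ⟨h, _⟩ | ⟨u', d', hu', rfl, hs⟩
      · exact absurd h hlt.ne
      by_cases hne : u' = u
      · subst hne
        rw [huniq _ hs hdr.tail]
      · exact absurd hdr (h3 u' d' hu' hne hd)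
    · intro d hd hne
      rcases hd.cases with ⟨h, _⟩ | ⟨u', d', hu', rfl, hs⟩
      · exact absurd h hlt.ne
      rw [edgeLabels_cons_cons, edgeLabels_cons_cons]
      by_cases hu : u' = u
      · subst hu
        exact List.Lex.cons (hlex _ hs fun h => hne (by rw [h]))
      · exact List.Lex.rel (h2 u' hu' hs.le hu)

/-! ### The labeling induced by a chain of left-modular elements -/

section LeftModular

variable {L : Type*} [Lattice L]

/-- Indexing by all of `ℕ`, with the last element repeated forever, avoids index bounds; the price
is weak covers instead of covers. -/
theorem exists_nat_chain {x z : L} {c : List L} (h : IsSaturatedChain x z c) :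
    ∃ (X : ℕ → L) (n : ℕ), X 0 = x ∧ X n = z ∧ (∀ i, X i ⩿ X (i + 1)) ∧ ∀ i, X i ∈ c := by
  refine h.induction (motive := fun x c => ∃ (X : ℕ → L) (n : ℕ), X 0 = x ∧ X n = z ∧
    (∀ i, X i ⩿ X (i + 1)) ∧ ∀ i, X i ∈ c) ⟨fun _ => z, 0, rfl, rfl, fun _ => WCovBy.refl _, by simp⟩ ?_
  rintro x y c hxy - ⟨X, n, h0, hn, hs, hm⟩
  refine ⟨fun i => i.casesOn x X, n + 1, rfl, hn, ?_, ?_⟩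
  · rintro (_ | i)
    · exact (h0 ▸ hxy.wcovBy : x ⩿ X 0)
    · exact hs i
  · rintro (_ | i)
    · simp
    · exact List.mem_cons_of_mem _ (hm i)

theorem IsLeftModularElem.le {p : L} (hp : IsLeftModularElem p) {q q' : L} (h : q ≤ q') :
    (q ⊔ p) ⊓ q' ≤ q ⊔ (p ⊓ q') := by
  rcases h.eq_or_lt with rfl | h
  · exact inf_le_right.trans le_sup_left
  · exact (hp q q' h).le

/-- For a cover `v ⋖ v'` and a left-modular `p`, either `v' ≤ v ⊔ p` or `p ⊓ v' ≤ v`. -/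
theorem IsLeftModularElem.inf_le_iff {p v v' : L} (hp : IsLeftModularElem p) (h : v ⋖ v') :
    p ⊓ v' ≤ v ↔ ¬ v' ≤ v ⊔ p := by
  constructor
  · intro h1 h2
    have := hp v v' h.lt
    rw [inf_eq_right.2 h2, sup_eq_left.2 h1] at this
    exact h.lt.ne' this
  · intro h1
    by_contra h2
    rcases h.eq_or_eq (c := v ⊔ (p ⊓ v')) le_sup_left (sup_le h.le inf_le_right) with h3 | h3
    · exact h2 (sup_eq_left.1 h3)
    · exact h1 (h3.ge.trans (sup_le_sup_left inf_le_left _))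

/-- The projection of a cover of left-modular elements to an interval is a weak cover. -/
theorem wcovBy_sup_inf {p p' y z : L} (hp : IsLeftModularElem p) (hp' : IsLeftModularElem p')
    (h : p ⩿ p') (hyz : y ≤ z) : y ⊔ (p ⊓ z) ⩿ y ⊔ (p' ⊓ z) := by
  refine wcovBy_of_eq_or_eq (sup_le_sup_left (inf_le_inf_right _ h.le) _) fun w h1 h2 => ?_
  have hyw : y ≤ w := le_sup_left.trans h1
  have hwz : w ≤ z := h2.trans (sup_le hyz inf_le_right)
  rcases h.eq_or_eq (c := p ⊔ (w ⊓ p')) le_sup_left (sup_le h.le inf_le_right) with h3 | h3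
  · left
    refine le_antisymm ?_ h1
    have hw : w ⊓ p' ≤ p := sup_eq_left.1 h3
    calc w ≤ (y ⊔ p') ⊓ w := le_inf (h2.trans (sup_le_sup_left inf_le_left _)) le_rfl
      _ ≤ y ⊔ (p' ⊓ w) := hp'.le hyw
      _ ≤ y ⊔ (p ⊓ z) := sup_le_sup_left
          (le_inf ((inf_comm p' w).le.trans hw) (inf_le_right.trans hwz)) _
  · right
    refine le_antisymm h2 ?_
    have hw : p' ≤ w ⊔ p :=
      h3.ge.trans (sup_le le_sup_right (inf_le_left.trans le_sup_left))
    calc y ⊔ (p' ⊓ z) ≤ (w ⊔ p) ⊓ z :=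
          sup_le (le_inf (hyw.trans le_sup_left) hyz) (inf_le_inf_right _ hw)
      _ ≤ w ⊔ (p ⊓ z) := hp.le hwz
      _ ≤ w := sup_le le_rfl (le_sup_right.trans h1)

/-- The labeling of a lattice determined by a sequence of elements. -/
noncomputable def seqLabel (X : ℕ → L) (y z : L) : ℕ := sInf {i | z ≤ y ⊔ X i}

/-- In `[y, z]`, let `i + 1` be the least index with `X (i + 1) ⊓ z` not below `y`. The first atom
is `y ⊔ (X (i + 1) ⊓ z)`, with label at most `i + 1`; left-modularity shows that all other atoms of
the interval, and all covers above this atom, have labels exceeding `i + 1`. -/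
theorem isELLabeling_seqLabel [Finite L] {X : ℕ → L} {n : ℕ} (h0 : IsBot (X 0))
    (hn : IsTop (X n)) (hX : ∀ i, X i ⩿ X (i + 1)) (hlm : ∀ i, IsLeftModularElem (X i)) :
    IsELLabeling (seqLabel X) := by
  have hmono : Monotone X := monotone_nat_of_le_succ fun i => (hX i).le
  have key : ∀ y z j, seqLabel X y z ≤ j ↔ z ≤ y ⊔ X j := by
    intro y z j
    have hne : {i | z ≤ y ⊔ X i}.Nonempty := ⟨n, (hn z).trans le_sup_right⟩
    refine ⟨fun h => (Nat.sInf_mem hne).trans (sup_le_sup_left (hmono h) _), fun h => Nat.sInf_le h⟩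
  have key' : ∀ v v' j, v ⋖ v' → (j < seqLabel X v v' ↔ X j ⊓ v' ≤ v) := by
    intro v v' j hv
    rw [(hlm j).inf_le_iff hv, ← key, not_le]
  refine isELLabeling_of_first_atom fun y z hyz => ?_
  have hex : ∃ i, ¬ X i ⊓ z ≤ y := ⟨n, fun h => hyz.not_ge ((le_inf (hn z) le_rfl).trans h)⟩
  classical
  obtain ⟨i, hi⟩ : ∃ i, Nat.find hex = i + 1 := by
    refine Nat.exists_eq_succ_of_ne_zero fun h => ?_
    exact Nat.find_spec hex (inf_le_left.trans ((congrArg X h).le.trans (h0 y)))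
  have hi1 : ¬ X (i + 1) ⊓ z ≤ y := hi ▸ Nat.find_spec hex
  have hi0 : X i ⊓ z ≤ y := not_not.1 (Nat.find_min hex (hi ▸ Nat.lt_succ_self i))
  -- By minimality `X i` projects to `y` itself, so projecting `X i ⩿ X (i + 1)` yields an atom of
  -- the interval.
  have hw := wcovBy_sup_inf (hlm i) (hlm (i + 1)) (hX i) hyz.le
  rw [sup_eq_left.2 hi0] at hw
  have hcov : y ⋖ y ⊔ (X (i + 1) ⊓ z) := hw.covBy_of_ne fun h => hi1 (sup_eq_left.1 h.symm)
  have hlow : seqLabel X y (y ⊔ (X (i + 1) ⊓ z)) ≤ i + 1 :=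
    (key _ _ _).2 (sup_le_sup_left inf_le_left _)
  have hother : ∀ u', y ⋖ u' → u' ≤ z → u' ≠ y ⊔ (X (i + 1) ⊓ z) → i + 1 < seqLabel X y u' := by
    intro u' hu' hz hne
    by_contra hle
    have h1 := (key _ _ _).1 (not_lt.1 hle)
    have h2 : u' ≤ y ⊔ (X (i + 1) ⊓ z) := (le_inf h1 hz).trans ((hlm _).le hyz.le)
    exact (hcov.eq_or_eq hu'.le h2).elim hu'.lt.ne' hne
  refine ⟨_, hcov, sup_le hyz.le inf_le_right, ?_, ?_, ?_⟩
  · intro v v' huv hv hz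
    refine hlow.trans_lt ((key' _ _ _ hv).2 ?_)
    exact (inf_le_inf_left _ hz).trans (le_sup_right.trans huv)
  · exact fun u' hu' hz hne => hlow.trans_lt (hother u' hu' hz hne)
  · intro u' c hu' hne hs hr
    -- If all labels on a chain to `z` exceed `k`, then `X k ⊓ z` descends along the chain, one
    -- cover at a time. For a rising chain through another atom and `k = i + 1` this contradicts the
    -- choice of `i`.
    have claim : ∀ x d, IsSaturatedChain x z d → ∀ k, (∀ l ∈ edgeLabels (seqLabel X) d, k < l) →
        X k ⊓ z ≤ x := by
      intro x d hd k
      refine hd.induction (motive := fun x d => (∀ l ∈ edgeLabels (seqLabel X) d, k < l) →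
        X k ⊓ z ≤ x) (fun _ => inf_le_right) ?_
      intro x v d hxv _ ih hl
      rw [edgeLabels_cons_cons] at hl
      have h1 := (key' _ _ _ hxv).1 (hl _ List.mem_cons_self)
      exact (le_inf inf_le_left (ih fun l hm => hl l (List.mem_cons_of_mem _ hm))).trans h1
    refine hi1 (claim _ _ hs _ ?_)
    unfold IsRising at hr
    rw [edgeLabels_cons_cons] at hr ⊢
    have hle : u' ≤ z := by
      rcases hs.cases with ⟨h, _⟩ | ⟨v, c', _, h, hs'⟩
      · exact absurd h hyz.ne
      · simp only [List.cons.injEq, true_and] at h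
        exact h.1 ▸ hs'.le
    have hfirst := hother u' hu' hle hne
    intro l hl
    rcases List.mem_cons.1 hl with rfl | hl
    · exact hfirst
    · exact hfirst.trans ((List.pairwise_cons.1 hr.pairwise).1 l hl)

end LeftModular

theorem IsLeftModularLattice.isELShellable {P : Type*} [PartialOrder P] [Finite P]
    (h : IsLeftModularLattice P) : IsELShellable P := by
  obtain ⟨hL, bot, top, c, hbot, htop, hc, hlm⟩ := h
  let := hL.toLattice
  obtain ⟨X, n, h0, hn, hs, hm⟩ := exists_nat_chain hc
  exact ⟨⟨bot, hbot⟩, ⟨top, htop⟩, ℕ, inferInstance, _,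
    isELLabeling_seqLabel (X := X) (n := n) (h0 ▸ hbot) (hn ▸ htop) hs fun i => hlm _ (hm i)⟩

/-! ### Basic structure of the cover poset -/

section MCover

variable {P : Type*} [PartialOrder P] [BoundedOrder P]

theorem exists_forall_iff_lt {m : ℕ} {A : Fin m → Prop} (hA : ∀ i j, i ≤ j → A j → A i) :
    ∃ l ≤ m, ∀ i : Fin m, A i ↔ (i : ℕ) < l := by
  classical
  have hex : ∃ l, ∀ i : Fin m, A i → (i : ℕ) < l := ⟨m, fun i _ => i.2⟩
  refine ⟨Nat.find hex, Nat.find_min' hex fun i _ => i.2, fun i =>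
    ⟨Nat.find_spec hex i, fun hi => ?_⟩⟩
  have := Nat.find_min hex hi
  push Not at this
  obtain ⟨j, hj, hij⟩ := this
  exact hA i j hij hj

/-- Membership in the `m`-cover poset, in terms of pairs of entries. -/
theorem mem_mCover_iff [Finite P] {m : ℕ} {f : Fin m → P} :
    (f = ⊥ ∨ ∃ p q : P, p ⋖ q ∧ ∃ l₀ l₁ l₂ : ℕ, l₀ + l₁ + l₂ = m ∧ f = mTuple m l₀ l₁ p q) ↔
      ∀ i j, i ≤ j → f i = ⊥ ∨ f i ⩿ f j := by
  constructor
  · rintro (rfl | ⟨p, q, hpq, l₀, l₁, l₂, -, rfl⟩) i j hij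
    · simp
    · have hij' : (i : ℕ) ≤ j := hij
      unfold mTuple
      by_cases h0 : (i : ℕ) < l₀
      · simp [h0]
      right
      rw [if_neg h0, if_neg (show ¬ (j : ℕ) < l₀ by omega)]
      by_cases h1 : (i : ℕ) < l₀ + l₁
      · rw [if_pos h1]
        split_ifs
        · exact WCovBy.refl _
        · exact hpq.wcovBy
      · rw [if_neg h1, if_neg (by omega)]
        exact WCovBy.refl _
  · intro h
    by_cases hf : f = ⊥
    · exact Or.inl hf
    right
    have hmono : ∀ i j, i ≤ j → f i ≤ f j := fun i j hij => by
      rcases h i j hij with h | h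
      · exact h.trans_le bot_le
      · exact h.le
    obtain ⟨i₀, hi₀⟩ : ∃ i, f i ≠ ⊥ := by
      by_contra hc
      push Not at hc
      exact hf (funext hc)
    obtain ⟨k, rfl⟩ : ∃ k, m = k + 1 := Nat.exists_eq_succ_of_ne_zero (by rintro rfl; exact i₀.elim0)
    have hlast : f (Fin.last k) ≠ ⊥ := fun h' => hi₀ (le_bot_iff.1 ((hmono _ _ i₀.le_last).trans h'.le))
    -- All entries other than `⊥` and the last one are covered by the last one and comparable, hence
    -- equal. If there are none, any lower cover of the last entry serves as `p`.
    obtain ⟨p, hpq, hp⟩ : ∃ p, p ⋖ f (Fin.last k) ∧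
        ∀ i, f i ≠ ⊥ → f i ≠ f (Fin.last k) → f i = p := by
      by_cases hex : ∃ i, f i ≠ ⊥ ∧ f i ≠ f (Fin.last k)
      · obtain ⟨i, hi, hi'⟩ := hex
        have hcov : ∀ j, f j ≠ ⊥ → f j ≠ f (Fin.last k) → f j ⋖ f (Fin.last k) := fun j hj hj' =>
          ((h j _ j.le_last).resolve_left hj).covBy_of_ne hj'
        refine ⟨f i, hcov i hi hi', fun j hj hj' => ?_⟩
        rcases le_total i j with hij | hij
        · exact ((hcov i hi hi').eq_or_eq (hmono _ _ hij) (hcov j hj hj').le).resolve_right hj'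
        · exact (((hcov j hj hj').eq_or_eq (hmono _ _ hij) (hcov i hi hi').le).resolve_right hi').symm
      · push Not at hex
        obtain ⟨p, -, hp⟩ := exists_le_covBy_of_lt (bot_lt_iff_ne_bot.2 hlast)
        exact ⟨p, hp, fun i hi hi' => absurd (hex i hi) hi'⟩
    obtain ⟨l₀, -, hl₀⟩ := exists_forall_iff_lt (A := fun i => f i = ⊥)
      fun i j hij hj => le_bot_iff.1 ((hmono _ _ hij).trans hj.le)
    obtain ⟨l, hlm, hl⟩ := exists_forall_iff_lt (A := fun i => f i ≠ f (Fin.last k))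
      fun i j hij hj hi => hj (le_antisymm (hmono _ _ j.le_last) (hi ▸ hmono _ _ hij))
    have hl₀l : l₀ ≤ l := by
      by_contra hlt
      push Not at hlt
      have hlk : l < k + 1 := by
        by_contra hge
        exact hlast ((hl₀ (Fin.last k)).2 (by simp; omega))
      have h1 := (hl₀ ⟨l, hlk⟩).2 hlt
      have h2 := (hl ⟨l, hlk⟩).1 (by simp only [h1]; exact hlast.symm)
      simp at h2
    refine ⟨p, _, hpq, l₀, l - l₀, k + 1 - l, by omega, funext fun i => ?_⟩
    unfold mTuple
    split_ifs with h0 h1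
    · exact (hl₀ i).2 h0
    · exact hp i (fun h' => h0 ((hl₀ i).1 h')) ((hl i).2 (by omega))
    · by_contra h2
      have := (hl i).1 h2
      omega

/-- The meet of two image points lies below one of them and their join below `f ⊤`, so both stay in
the range. -/
theorem IsLatticePoset.of_isLowerSet {Q : Type*} [PartialOrder Q] {f : P ↪o Q}
    (hf : IsLowerSet (Set.range f)) (h : IsLatticePoset Q) : IsLatticePoset P := by
  intro p q
  obtain ⟨⟨j, hj⟩, i, hi⟩ := h (f p) (f q)
  constructor
  · obtain ⟨j, rfl⟩ := hf (hj.2 (show f ⊤ ∈ _ by simp [upperBounds])) ⟨⊤, rfl⟩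
    refine ⟨j, ?_, fun b hb => ?_⟩
    · have := hj.1
      simpa [upperBounds] using this
    · exact f.le_iff_le.1 (hj.2 (by simpa [upperBounds] using hb))
  · obtain ⟨i, rfl⟩ := hf (hi.1 (show f p ∈ _ by simp)) ⟨p, rfl⟩
    refine ⟨i, ?_, fun b hb => ?_⟩
    · have := hi.1
      simpa [lowerBounds] using this
    · exact f.le_iff_le.1 (hi.2 (by simpa [lowerBounds] using hb))

theorem mem_mCover_pair {p q : P} (h : p ⩿ q) (i j : Fin 2) (hij : i ≤ j) :
    ![p, q] i = ⊥ ∨ ![p, q] i ⩿ ![p, q] j := by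
  right
  fin_cases i <;> fin_cases j
  · exact WCovBy.refl _
  · exact h
  · simp at hij
  · exact WCovBy.refl _

variable [Finite P]

/-- A tuple as an element of the `m`-cover poset. -/
def MCover.mk {m : ℕ} (f : Fin m → P) (h : ∀ i j, i ≤ j → f i = ⊥ ∨ f i ⩿ f j) : MCover P m :=
  ⟨f, mem_mCover_iff.2 h⟩

theorem MCover.eq_bot_or_wcovBy {m : ℕ} (x : MCover P m) {i j : Fin m} (hij : i ≤ j) :
    x.1 i = ⊥ ∨ x.1 i ⩿ x.1 j := mem_mCover_iff.1 x.2 i j hij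

theorem MCover.wcovBy {m : ℕ} (x : MCover P m) {i j : Fin m} (hij : i ≤ j) (h : x.1 i ≠ ⊥) :
    x.1 i ⩿ x.1 j := (x.eq_bot_or_wcovBy hij).resolve_left h

theorem MCover.monotone {m : ℕ} (x : MCover P m) : Monotone x.1 := fun i j hij => by
  rcases x.eq_bot_or_wcovBy hij with h | h
  · exact h.trans_le bot_le
  · exact h.le

/-- The embedding of `P` into its `m`-cover poset which places an element at the last entry. -/
def lastEmbedding (P : Type*) [PartialOrder P] [BoundedOrder P] [Finite P] (k : ℕ) :
    P ↪o MCover P (k + 1) :=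
  OrderEmbedding.ofMapLEIff
    (fun x => MCover.mk (fun i => if i = Fin.last k then x else ⊥) fun i j hij => by
      by_cases hi : i = Fin.last k
      · subst hi
        rw [Fin.last_le_iff.1 hij]
        exact Or.inr (WCovBy.refl _)
      · exact Or.inl (if_neg hi))
    fun x y => by
      constructor
      · intro h
        simpa [MCover.mk] using h (Fin.last k)
      · intro h i
        by_cases hi : i = Fin.last k <;> simp [MCover.mk, hi, h]

theorem lastEmbedding_isLowerSet (k : ℕ) : IsLowerSet (Set.range (lastEmbedding P k)) := by
  rintro _ y hy ⟨x, rfl⟩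
  refine ⟨y.1 (Fin.last k), Subtype.ext (funext fun i => ?_)⟩
  by_cases hi : i = Fin.last k
  · simp [lastEmbedding, MCover.mk, hi]
  · have := hy i
    simp only [lastEmbedding, MCover.mk, OrderEmbedding.coe_ofMapLEIff, if_neg hi, le_bot_iff]
      at this ⊢
    exact this.symm

theorem isLatticePoset_of_mCover {k : ℕ} (h : IsLatticePoset (MCover P (k + 1))) :
    IsLatticePoset P :=
  h.of_isLowerSet (lastEmbedding_isLowerSet k)

/-- If the `2`-cover poset is a lattice, then removing the least element leaves a rooted tree. -/
theorem eq_of_covBy_of_mCover_two (h : IsLatticePoset (MCover P 2)) {p q q' : P} (hp : p ≠ ⊥)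
    (hq : p ⋖ q) (hq' : p ⋖ q') : q = q' := by
  obtain ⟨j, hj⟩ := (isLatticePoset_of_mCover h q q').1
  obtain ⟨J, hJ⟩ := (h (.mk _ (mem_mCover_pair hq.wcovBy)) (.mk _ (mem_mCover_pair hq'.wcovBy))).1
  have hqj : q ≤ j := hj.1 (by simp)
  have hqj' : q' ≤ j := hj.1 (by simp)
  -- `(c, j)` is an upper bound of `(p, q)` and `(p, q')`, hence lies above their join `J`.
  have hub : ∀ c (hc : c ⩿ j), p ≤ c → J.1 0 ≤ c ∧ J.1 1 ≤ j := by
    intro c hc hpc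
    have : J ≤ .mk _ (mem_mCover_pair hc) := hJ.2 (by
      simp only [upperBounds, Set.mem_insert_iff, Set.mem_singleton_iff, forall_eq_or_imp,
        forall_eq, Set.mem_ofPred_eq]
      constructor <;> intro i <;> fin_cases i <;> simpa [MCover.mk])
    exact ⟨this 0, this 1⟩
  have hJ1 := hJ.1 (show _ ∈ _ from Set.mem_insert _ _)
  have hJ2 := hJ.1 (show _ ∈ _ from Set.mem_insert_of_mem _ rfl)
  have hpJ : p ≤ J.1 0 := hJ1 0
  have hJj : J.1 1 = j := by
    refine le_antisymm (hub j (WCovBy.refl _) (hq.le.trans hqj)).2 (hj.2 ?_)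
    rintro x (rfl | rfl)
    · exact hJ1 1
    · exact hJ2 1
  -- Here `p ≠ ⊥` enters: it excludes a first entry `⊥`, which need not be covered by `j`.
  have hJ0 : J.1 0 ⩿ j :=
    hJj ▸ J.wcovBy (zero_le_one) fun h0 => hp (le_bot_iff.1 (hpJ.trans h0.le))
  -- A lower cover `c` of `j` above `r` satisfies `J.1 0 ≤ c`, and `J.1 0 ⩿ j` forces equality.
  have hstep : ∀ r r', p ⋖ r → p ⋖ r' → r ≠ r' → r ≤ j → r' ≤ j → r ≤ J.1 0 := by
    intro r r' hr hr' hne hrj hrj'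
    have hlt : r < j := hrj.lt_of_ne fun h' =>
      (hr.eq_or_eq hr'.le (hrj'.trans h'.ge)).elim hr'.lt.ne' hne.symm
    obtain ⟨c, hrc, hcj⟩ := exists_le_covBy_of_lt hlt
    have hle := (hub c hcj.wcovBy (hr.le.trans hrc)).1
    exact ((hJ0.eq_or_eq hle hcj.le).resolve_right hcj.lt.ne) ▸ hrc
  by_contra hne
  have h1 := hstep q q' hq hq' hne hqj hqj'
  have h2 := hstep q' q hq' hq (Ne.symm hne) hqj' hqj
  -- Both `q` and `q'` lie below `J.1 0`, hence so does `j`; yet `J.1 0` lies below a lower cover of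
  -- `j`.
  have h3 : j ≤ J.1 0 := hj.2 (by rintro x (rfl | rfl) <;> assumption)
  have hlt : q < j := hqj.lt_of_ne fun h' =>
      (hq.eq_or_eq hq'.le (hqj'.trans h'.ge)).elim hq'.lt.ne' (Ne.symm hne)
  obtain ⟨c, hrc, hcj⟩ := exists_le_covBy_of_lt hlt
  exact (h3.trans (hub c hcj.wcovBy (hq.le.trans hrc)).1).not_gt hcj.lt

end MCover

/-! ### Posets in which nonzero elements have at most one upper cover -/

/-- Removing the least element leaves a tree, rooted at the greatest element: every nonzero
element has at most one upper cover. -/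
def IsTreeLike (P : Type*) [PartialOrder P] [OrderBot P] : Prop :=
  ∀ p q q' : P, p ≠ ⊥ → p ⋖ q → p ⋖ q' → q = q'

/-- An element above some nonzero element. -/
def IsHigh {P : Type*} [PartialOrder P] [OrderBot P] (y : P) : Prop :=
  ∃ x, x ≠ ⊥ ∧ x < y

section Tree

variable {P : Type*} [PartialOrder P] [BoundedOrder P]

theorem IsHigh.ne_bot {y : P} (h : IsHigh y) : y ≠ ⊥ := by
  obtain ⟨x, -, hx⟩ := h
  exact (bot_le.trans_lt hx).ne'

theorem IsHigh.mono {y z : P} (h : IsHigh y) (hyz : y ≤ z) : IsHigh z := by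
  obtain ⟨x, hx, hxy⟩ := h
  exact ⟨x, hx, hxy.trans_le hyz⟩

theorem isAtom_of_not_isHigh {y : P} (h0 : y ≠ ⊥) (h : ¬ IsHigh y) : IsAtom y :=
  ⟨h0, fun x hx => by_contra fun hx0 => h ⟨x, hx0, hx⟩⟩

variable [Finite P]

/-- Climb from `x`: the first steps towards `y` and towards `z` are the same unique cover. -/
theorem IsTreeLike.total (hT : IsTreeLike P) {x y z : P} (hx : x ≠ ⊥) (hy : x ≤ y) (hz : x ≤ z) :
    y ≤ z ∨ z ≤ y := by
  induction x using WellFoundedGT.induction with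
  | ind x ih =>
    rcases hy.eq_or_lt with rfl | hy
    · exact Or.inl hz
    rcases hz.eq_or_lt with rfl | hz
    · exact Or.inr hy.le
    obtain ⟨u, hxu, huy⟩ := exists_covBy_le_of_lt hy
    obtain ⟨v, hxv, hvz⟩ := exists_covBy_le_of_lt hz
    obtain rfl := hT x u v hx hxu hxv
    exact ih u hxu.lt (bot_le.trans_lt hxu.lt).ne' huy hvz

theorem IsTreeLike.le_of_wcovBy (hT : IsTreeLike P) {x y z : P} (hx : x ≠ ⊥) (hy : x ⩿ y)
    (hz : x < z) : y ≤ z := by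
  rcases hT.total hx hy.le hz.le with h | h
  · exact h
  · exact ((hy.eq_or_eq hz.le h).resolve_left hz.ne').ge

theorem IsTreeLike.mem_of_isSaturatedChain (hT : IsTreeLike P) {x z y : P} {c : List P}
    (hx : x ≠ ⊥) (hc : IsSaturatedChain x z c) (hxy : x ≤ y) (hyz : y ≤ z) : y ∈ c := by
  revert hx hxy
  refine hc.induction (motive := fun x c => x ≠ ⊥ → x ≤ y → y ∈ c)
    (fun _ h => by simp [le_antisymm hyz h]) ?_
  intro x v d hxv _ ih hx hxy
  rcases hxy.eq_or_lt with rfl | hlt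
  · simp
  · exact List.mem_cons_of_mem _
      (ih (bot_le.trans_lt hxv.lt).ne' (hT.le_of_wcovBy hx hxv.wcovBy hlt))

/-- Two incomparable high elements have no common nonzero lower bound, so with witnesses below them
they form a `2+2`. Conversely, the lower elements of a `2+2` are nonzero, so its upper elements are
high. -/
theorem IsTreeLike.isTwoPlusTwoFree_iff (hT : IsTreeLike P) :
    IsTwoPlusTwoFree P ↔ ∀ y y' : P, IsHigh y → IsHigh y' → y ≤ y' ∨ y' ≤ y := by
  constructor
  · rintro h y y' ⟨x, hx, hxy⟩ ⟨x', hx', hxy'⟩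
    by_contra hc
    push Not at hc
    refine h ⟨x, y, x', y', hxy, hxy', ⟨?_, ?_, ?_, hc.1⟩, ?_, ?_, ?_, hc.2⟩
    · exact fun h' => (hT.total hx hxy.le (h'.trans hxy'.le)).elim hc.1 hc.2
    · exact fun h' => (hT.total hx hxy.le h').elim hc.1 hc.2
    · exact fun h' => hc.1 (h'.trans hxy'.le)
    · exact fun h' => (hT.total hx' (h'.trans hxy.le) hxy'.le).elim hc.1 hc.2
    · exact fun h' => (hT.total hx' h' hxy'.le).elim hc.1 hc.2
    · exact fun h' => hc.2 (h'.trans hxy.le)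
  · rintro h ⟨x, y, x', y', hxy, hxy', h1, h2⟩
    rcases h y y' ⟨x, fun h' => h1.1 (h' ▸ bot_le), hxy⟩ ⟨x', fun h' => h2.1 (h' ▸ bot_le), hxy'⟩
      with h' | h'
    · exact h1.2.2.2 h'
    · exact h2.2.2.2 h'

end Tree

/-! ### EL-shellability of the `m`-cover poset forces freeness of `2+2` -/

section EL

theorem edgeLabels_map {P Q Λ : Type*} (f : P → Q) (lab : Q → Q → Λ) (c : List P) :
    edgeLabels lab (c.map f) = edgeLabels (fun p q => lab (f p) (f q)) c := by
  simp [edgeLabels, ← List.map_tail, List.zipWith_map]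

variable {P Q : Type*} [PartialOrder P] [PartialOrder Q]

theorem covBy_apply_of_isLowerSet {f : P ↪o Q} (hf : IsLowerSet (Set.range f)) {x y : P} :
    f x ⋖ f y ↔ x ⋖ y :=
  ⟨fun h => h.of_image f, fun h => h.image f hf.ordConnected⟩

theorem isSaturatedChain_map_iff {f : P ↪o Q} (hf : IsLowerSet (Set.range f)) {x y : P}
    {c : List P} : IsSaturatedChain (f x) (f y) (c.map f) ↔ IsSaturatedChain x y c := by
  simp [IsSaturatedChain, List.isChain_map, covBy_apply_of_isLowerSet hf, List.getLast?_map]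

theorem IsSaturatedChain.exists_map_eq {f : P ↪o Q} (hf : IsLowerSet (Set.range f)) {a : Q} {y : P}
    {c : List Q} (hc : IsSaturatedChain a (f y) c) : ∃ d : List P, c = d.map f := by
  refine hc.induction (motive := fun _ c => ∃ d : List P, c = d.map f) ⟨[y], rfl⟩ ?_
  rintro x z e hxz hs ⟨d, hd⟩
  obtain ⟨x', rfl⟩ := hf (hxz.le.trans hs.le) ⟨y, rfl⟩
  exact ⟨x' :: d, by rw [hd, List.map_cons]⟩

/-- A saturated chain ending in a lower set stays inside it, so intervals of `P` have the same
saturated chains as their images. -/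
theorem IsELLabeling.comp {Λ : Type*} [PartialOrder Λ] {lab : Q → Q → Λ} (h : IsELLabeling lab)
    {f : P ↪o Q} (hf : IsLowerSet (Set.range f)) :
    IsELLabeling (fun p q => lab (f p) (f q)) := by
  intro x y hxy
  obtain ⟨c, hc, hr, hu, hl⟩ := h (f x) (f y) (f.le_iff_le.2 hxy)
  obtain ⟨d, rfl⟩ := hc.exists_map_eq hf
  refine ⟨d, (isSaturatedChain_map_iff hf).1 hc, ?_, fun e he hr => ?_, fun e he hne => ?_⟩
  · unfold IsRising at hr ⊢
    rwa [edgeLabels_map] at hr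
  · refine List.map_injective_iff.2 f.injective (hu _ ((isSaturatedChain_map_iff hf).2 he) ?_)
    unfold IsRising at hr ⊢
    rwa [edgeLabels_map]
  · have := hl _ ((isSaturatedChain_map_iff hf).2 he)
      fun h' => hne (List.map_injective_iff.2 f.injective h')
    rwa [edgeLabels_map, edgeLabels_map] at this

theorem IsSaturatedChain.total {x z y y' : P} {c : List P} (hc : IsSaturatedChain x z c)
    (hy : y ∈ c) (hy' : y' ∈ c) : y ≤ y' ∨ y' ≤ y := by
  have hp : c.Pairwise (· ≤ ·) := (hc.1.imp fun _ _ h => h.le).pairwise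
  rcases List.mem_iff_getElem.1 hy with ⟨i, hi, rfl⟩
  rcases List.mem_iff_getElem.1 hy' with ⟨j, hj, rfl⟩
  rcases lt_trichotomy i j with h | rfl | h
  · exact Or.inl (List.pairwise_iff_getElem.1 hp _ _ _ _ h)
  · exact Or.inl le_rfl
  · exact Or.inr (List.pairwise_iff_getElem.1 hp _ _ _ _ h)

/-- For `y` high, the rising chain of `[⊥, y]` starts `⊥ ⋖ a ⋖ b`. The rising chain of `[a, ⊤]` must
also step to `b`, so prepending `⊥` keeps it rising and gives the unique rising chain `R` of `P`. It
contains `y`, since `[a, ⊤]` is a chain. -/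
theorem IsELLabeling.isTwoPlusTwoFree [BoundedOrder P] [Finite P] (hT : IsTreeLike P) {Λ : Type*}
    [PartialOrder Λ] {lab : P → P → Λ} (h : IsELLabeling lab) : IsTwoPlusTwoFree P := by
  rw [hT.isTwoPlusTwoFree_iff]
  obtain ⟨R, hR, -, hRu, -⟩ := h (⊥ : P) ⊤ bot_le
  have key : ∀ y : P, IsHigh y → y ∈ R := by
    rintro y hy
    obtain ⟨c, hc, hr, -, -⟩ := h ⊥ y bot_le
    rcases hc.cases with ⟨h0, -⟩ | ⟨a, c', ha, rfl, hc₁⟩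
    · exact absurd h0.symm hy.ne_bot
    rcases hc₁.cases with ⟨rfl, -⟩ | ⟨b, c'', hab, hcb, hc₂⟩
    · obtain ⟨x, hx, hxy⟩ := hy
      exact absurd hxy (ha.2 (bot_lt_iff_ne_bot.2 hx))
    obtain rfl := (List.cons.inj hcb).2
    obtain ⟨r, hs, hrr, -, -⟩ := h a ⊤ le_top
    obtain ⟨r', rfl⟩ := hs.exists_eq_cons
    have hsat := hs.cons ha
    have hrise : IsRising lab (⊥ :: a :: r') := by
      refine isRising_of_forall_lt hrr ?_
      rintro z e rfl
      rcases hs.cases with ⟨-, h'⟩ | ⟨z', e', haz, h', -⟩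
      · simp at h'
      · simp only [List.cons.injEq, true_and] at h'
        obtain ⟨rfl, rfl⟩ := h'
        rw [← hT a b z ha.lt.ne' hab haz]
        unfold IsRising at hr
        rw [edgeLabels_cons_cons, edgeLabels_cons_cons] at hr
        exact (List.isChain_cons_cons.1 hr).1
    rw [← hRu _ hsat hrise]
    exact List.mem_cons_of_mem _
      (hT.mem_of_isSaturatedChain ha.lt.ne' hs (hab.le.trans hc₂.le) le_top)
  exact fun y y' hy hy' => hR.total (key y hy) (key y' hy')

theorem isTwoPlusTwoFree_of_isELShellable_mCover [BoundedOrder P] [Finite P] (hT : IsTreeLike P)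
    {k : ℕ} (h : IsELShellable (MCover P (k + 1))) : IsTwoPlusTwoFree P := by
  obtain ⟨-, -, Λ, _, lab, hlab⟩ := h
  exact (hlab.comp (lastEmbedding_isLowerSet k)).isTwoPlusTwoFree hT

end EL

/-! ### Freeness of `2+2` makes the `m`-cover poset left-modular -/

section LeftModularMCover

/-- An atom below all elements that are not atoms. -/
def IsBaseAtom {P : Type*} [PartialOrder P] [OrderBot P] (a : P) : Prop :=
  IsAtom a ∧ ∀ y, IsHigh y → a ≤ y

/-- Take an atom below the least high element; if no element is high, `⊤` is itself an atom. -/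
theorem exists_isBaseAtom {P : Type*} [PartialOrder P] [BoundedOrder P] [Finite P] [Nontrivial P]
    (h : ∀ y y' : P, IsHigh y → IsHigh y' → y ≤ y' ∨ y' ≤ y) : ∃ a : P, IsBaseAtom a := by
  by_cases hex : ∃ y : P, IsHigh y
  · obtain ⟨c, hc⟩ := (Set.toFinite {y : P | IsHigh y}).exists_minimal hex
    obtain ⟨a, ha, hac⟩ := IsAtomic.eq_bot_or_exists_atom_le c |>.resolve_left hc.1.ne_bot
    refine ⟨a, ha, fun y hy => ?_⟩
    rcases h c y hc.1 hy with h' | h'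
    · exact hac.trans h'
    · exact hac.trans (hc.2 hy h')
  · push Not at hex
    exact ⟨⊤, isAtom_of_not_isHigh top_ne_bot (hex ⊤), fun y hy => absurd hy (hex y)⟩

variable {P : Type*} [Lattice P] [BoundedOrder P] [Finite P] {a : P}

/-- The nontrivial half of left-modularity of `d`. If `⊥ ≠ u < v` then `v` is high, so `d` and `v`
both lie above `a` and are comparable. -/
theorem IsBaseAtom.inf_le_sup (ha : IsBaseAtom a) (hT : IsTreeLike P) {d u v : P}
    (hd : d = ⊥ ∨ a ≤ d) (huv : u ≤ v) : (u ⊔ d) ⊓ v ≤ u ⊔ (d ⊓ v) := by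
  rcases hd with rfl | hd
  · simp
  by_cases hu : u = ⊥
  · simp [hu]
  rcases huv.eq_or_lt with rfl | hlt
  · exact inf_le_right.trans le_sup_left
  rcases hT.total ha.1.1 hd (ha.2 v ⟨u, hu, hlt⟩) with h | h
  · rw [inf_eq_left.2 h]; exact inf_le_left
  · rw [inf_eq_right.2 h]; exact inf_le_right.trans le_sup_right

/-- Upper bounds in the `m`-cover poset which are close to the entrywise join. -/
theorem exists_mCover_sup (hT : IsTreeLike P) {k : ℕ} (x y : MCover P (k + 1)) :
    ∃ J : MCover P (k + 1), x ≤ J ∧ y ≤ J ∧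
      J.1 (Fin.last k) = x.1 (Fin.last k) ⊔ y.1 (Fin.last k) ∧
      ∀ i, J.1 i = x.1 i ⊔ y.1 i ∨
        (x.1 i ⊔ y.1 i ≠ ⊥ ∧ x.1 i ⊔ y.1 i < J.1 i ∧ J.1 i ⋖ J.1 (Fin.last k)) := by
  classical
  set t := x.1 (Fin.last k) ⊔ y.1 (Fin.last k) with ht
  have hs : Monotone fun i => x.1 i ⊔ y.1 i := x.monotone.sup y.monotone
  have hst : ∀ i, x.1 i ⊔ y.1 i ≤ t := fun i => hs i.le_last
  have hc : ∀ i, ∃ c, x.1 i ⊔ y.1 i ≠ t → x.1 i ⊔ y.1 i ≤ c ∧ c ⋖ t := by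
    intro i
    by_cases h : x.1 i ⊔ y.1 i = t
    · exact ⟨t, fun h' => absurd h h'⟩
    · obtain ⟨c, hc⟩ := exists_le_covBy_of_lt ((hst i).lt_of_ne h)
      exact ⟨c, fun _ => hc⟩
  choose c hc using hc
  set J : Fin (k + 1) → P := fun i =>
    if x.1 i ⊔ y.1 i = ⊥ then ⊥ else if x.1 i ⊔ y.1 i = t then t else c i with hJ
  have hJt : ∀ i, x.1 i ⊔ y.1 i = t → J i = t := by
    intro i hi
    simp only [hJ, hi, if_true]
    split_ifs with h
    · exact h.symm
    · rfl
  have hJc : ∀ i, x.1 i ⊔ y.1 i ≠ ⊥ → x.1 i ⊔ y.1 i ≠ t → J i = c i := by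
    intro i hi hi'
    simp only [hJ, if_neg hi, if_neg hi']
  have hJb : ∀ i, x.1 i ⊔ y.1 i = ⊥ → J i = ⊥ := by
    intro i hi
    simp only [hJ, if_pos hi]
  have hle : ∀ i, x.1 i ⊔ y.1 i ≤ J i := by
    intro i
    by_cases h0 : x.1 i ⊔ y.1 i = ⊥
    · exact h0.le.trans bot_le
    by_cases h1 : x.1 i ⊔ y.1 i = t
    · rw [hJt i h1]; exact h1.le
    · rw [hJc i h0 h1]; exact (hc i h1).1
  have hmem : ∀ i j, i ≤ j → J i = ⊥ ∨ J i ⩿ J j := by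
    intro i j hij
    by_cases h0 : x.1 i ⊔ y.1 i = ⊥
    · exact Or.inl (hJb i h0)
    right
    have hsij : x.1 i ⊔ y.1 i ≤ x.1 j ⊔ y.1 j := hs hij
    have h0j : x.1 j ⊔ y.1 j ≠ ⊥ := fun h => h0 (le_bot_iff.1 (hsij.trans h.le))
    by_cases h1 : x.1 i ⊔ y.1 i = t
    · rw [hJt i h1, hJt j (le_antisymm (hst j) (h1 ▸ hsij))]
      exact WCovBy.refl _
    rw [hJc i h0 h1]
    by_cases h1j : x.1 j ⊔ y.1 j = t
    · rw [hJt j h1j]; exact (hc i h1).2.wcovBy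
    rw [hJc j h0j h1j]
    have hi := hc i h1
    have hj := hc j h1j
    -- Two lower covers of `t` above the same nonzero element are comparable, hence equal.
    rcases hT.total h0 hi.1 (hsij.trans hj.1) with h | h
    · rw [(hi.2.eq_or_eq h hj.2.le).resolve_right hj.2.lt.ne]
      exact WCovBy.refl _
    · rw [(hj.2.eq_or_eq h hi.2.le).resolve_right hi.2.lt.ne]
      exact WCovBy.refl _
  refine ⟨.mk J hmem, fun i => le_sup_left.trans (hle i), fun i => le_sup_right.trans (hle i),
    hJt _ rfl, fun i => ?_⟩
  change J i = _ ∨ (_ ∧ _ < J i ∧ J i ⋖ J (Fin.last k))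
  by_cases h0 : x.1 i ⊔ y.1 i = ⊥
  · exact Or.inl ((hJb i h0).trans h0.symm)
  by_cases h1 : x.1 i ⊔ y.1 i = t
  · exact Or.inl ((hJt i h1).trans h1.symm)
  rw [hJc i h0 h1, hJt (Fin.last k) rfl]
  by_cases h2 : c i = x.1 i ⊔ y.1 i
  · exact Or.inl h2
  · exact Or.inr ⟨h0, (hc i h1).1.lt_of_ne' h2, (hc i h1).2⟩

/-- The `m`-cover poset is closed under entrywise meets. -/
theorem mem_mCover_inf (hT : IsTreeLike P) {m : ℕ} (x y : MCover P m) (i j : Fin m) (hij : i ≤ j) :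
    x.1 i ⊓ y.1 i = ⊥ ∨ x.1 i ⊓ y.1 i ⩿ x.1 j ⊓ y.1 j := by
  by_cases h0 : x.1 i ⊓ y.1 i = ⊥
  · exact Or.inl h0
  right
  have hx := x.wcovBy hij fun h => h0 (by simp [h])
  have hy := y.wcovBy hij fun h => h0 (by simp [h])
  have hmono := inf_le_inf (x.monotone hij) (y.monotone hij)
  rcases hT.total h0 inf_le_left inf_le_right with h | h
  · rw [inf_eq_left.2 h] at h0 hmono ⊢
    refine wcovBy_of_eq_or_eq hmono fun w h1 h2 => ?_
    rcases hx.eq_or_eq h1 (h2.trans inf_le_left) with h3 | h3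
    · exact Or.inl h3
    · exact Or.inr (le_antisymm h2 (h3 ▸ inf_le_left))
  · rw [inf_eq_right.2 h] at h0 hmono ⊢
    refine wcovBy_of_eq_or_eq hmono fun w h1 h2 => ?_
    rcases hy.eq_or_eq h1 (h2.trans inf_le_right) with h3 | h3
    · exact Or.inl h3
    · exact Or.inr (le_antisymm h2 (h3 ▸ inf_le_right))

/-- Where `J` is the entrywise join, this is the inequality in `P`. Elsewhere `J.1 i` is a lower
cover of the join of the last entries, so it cannot lie above the last entries of both `x` and `y`;
each case below either gives the inequality or violates this. -/
theorem IsBaseAtom.inf_le_of_mCover (ha : IsBaseAtom a) (hT : IsTreeLike P) {k : ℕ}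
    {x y y' w J : MCover P (k + 1)} (hx : ∀ i, x.1 i = ⊥ ∨ a ≤ x.1 i)
    (hx0 : ∀ i, x.1 i = ⊥ → x.1 (Fin.last k) ≤ a) (hyy' : y ≤ y') (hyw : y ≤ w)
    (hxw : ∀ i, x.1 i ⊓ y'.1 i ≤ w.1 i)
    (hJl : J.1 (Fin.last k) = y.1 (Fin.last k) ⊔ x.1 (Fin.last k))
    (hJ : ∀ i, J.1 i = y.1 i ⊔ x.1 i ∨
        (y.1 i ⊔ x.1 i ≠ ⊥ ∧ y.1 i ⊔ x.1 i < J.1 i ∧ J.1 i ⋖ J.1 (Fin.last k))) (i : Fin (k + 1)) :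
    J.1 i ⊓ y'.1 i ≤ w.1 i := by
  have entry : ∀ i, J.1 i = y.1 i ⊔ x.1 i → J.1 i ⊓ y'.1 i ≤ w.1 i := fun i hi => by
    rw [hi]
    exact (ha.inf_le_sup hT (hx i) (hyy' i)).trans (sup_le (hyw i) (hxw i))
  rcases hJ i with hi | ⟨hs0, hsJ, hJc⟩
  · exact entry i hi
  by_cases hz : J.1 i ⊓ y'.1 i = ⊥
  · exact hz.le.trans bot_le
  have haJ : IsHigh (J.1 i) := ⟨_, hs0, hsJ⟩
  have hnot : ¬ (y.1 (Fin.last k) ≤ J.1 i ∧ x.1 (Fin.last k) ≤ J.1 i) := fun h =>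
    hJc.lt.not_ge (hJl.le.trans (sup_le h.1 h.2))
  by_cases hxi : x.1 i = ⊥
  · rw [hxi, sup_bot_eq] at hs0 hsJ
    exact absurd ⟨hT.le_of_wcovBy hs0 (y.wcovBy i.le_last hs0) hsJ,
      (hx0 i hxi).trans (ha.2 _ haJ)⟩ hnot
  have hxJ : x.1 (Fin.last k) ≤ J.1 i :=
    hT.le_of_wcovBy hxi (x.wcovBy i.le_last hxi) (le_sup_right.trans_lt hsJ)
  have hyJ : ¬ y.1 (Fin.last k) ≤ J.1 i := fun h => hnot ⟨h, hxJ⟩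
  by_cases hg : x.1 i ⊓ y'.1 i = ⊥
  -- If `y'.1 i` were high, `a` would lie below the trivial meet. So it is an atom, strictly below
  -- the high element `J.1 i`, which then lies above the last entry of `y'`.
  · refine absurd ((hyy' _).trans ?_) hyJ
    have hy'0 : y'.1 i ≠ ⊥ := fun h => hz (by simp [h])
    have hy'a : IsAtom (y'.1 i) := isAtom_of_not_isHigh hy'0 fun h =>
      ha.1.1 (le_bot_iff.1 (hg ▸ le_inf ((hx i).resolve_left hxi) (ha.2 _ h)))
    have hy'J : y'.1 i ≤ J.1 i :=
      inf_eq_right.1 ((hy'a.le_iff.1 inf_le_right).resolve_left hz)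
    refine hT.le_of_wcovBy hy'0 (y'.wcovBy i.le_last hy'0) (hy'J.lt_of_ne fun h => ?_)
    obtain ⟨u, hu, hu'⟩ := haJ
    exact hu (hy'a.2 u (h ▸ hu'))
  · have hw0 : w.1 i ≠ ⊥ := fun h => hg (le_bot_iff.1 ((hxw i).trans h.le))
    have hgz : x.1 i ⊓ y'.1 i ≤ J.1 i ⊓ y'.1 i :=
      inf_le_inf_right _ (le_sup_right.trans hsJ.le)
    rcases hT.total hg hgz (hxw i) with h | h
    · exact h
    rcases h.eq_or_lt with h | h
    · exact h.ge
    have hzw : J.1 i ⊓ y'.1 i ≤ w.1 (Fin.last k) :=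
      (inf_le_inf (J.monotone i.le_last) (y'.monotone i.le_last)).trans (entry _ hJl)
    -- A meet strictly above `w.1 i` would be the last entry of `w`, putting the last entry of `y`
    -- below `J.1 i`.
    have heq := ((w.wcovBy i.le_last hw0).eq_or_eq h.le hzw).resolve_left h.ne'
    exact absurd ((hyw _).trans (heq.ge.trans inf_le_left)) hyJ

theorem isLeftModularElem_mCover (ha : IsBaseAtom a) (hT : IsTreeLike P) {k : ℕ}
    (h : IsLatticePoset (MCover P (k + 1))) {x : MCover P (k + 1)}
    (hx : ∀ i, x.1 i = ⊥ ∨ a ≤ x.1 i) (hx0 : ∀ i, x.1 i = ⊥ → x.1 (Fin.last k) ≤ a) :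
    @IsLeftModularElem _ h.toLattice x := by
  let := h.toLattice
  intro y y' hy
  refine le_antisymm ?_ (sup_le (le_inf le_sup_left hy.le) (inf_le_inf_right _ le_sup_right))
  obtain ⟨J, hyJ, hxJ, hJl, hJ⟩ := exists_mCover_sup hT y x
  have hmeet : (.mk _ (mem_mCover_inf hT x y') : MCover P (k + 1)) ≤ x ⊓ y' :=
    le_inf (fun i => inf_le_left) (fun i => inf_le_right)
  intro i
  refine le_trans ?_ (ha.inf_le_of_mCover hT hx hx0 hy.le (w := y ⊔ (x ⊓ y')) le_sup_left
    (fun i => (hmeet i).trans ((le_sup_right : x ⊓ y' ≤ y ⊔ (x ⊓ y')) i)) hJl hJ i)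
  refine le_inf ?_ ?_
  · exact (inf_le_left.trans (sup_le hyJ hxJ) : (y ⊔ x) ⊓ y' ≤ J) i
  · exact (inf_le_right : (y ⊔ x) ⊓ y' ≤ y') i

end LeftModularMCover

/-! ### The maximal chain of left-modular elements -/

section Chain

variable {P : Type*} [PartialOrder P] [BoundedOrder P] [Finite P] {p q a : P} {m : ℕ}

/-- The tuple with `l` entries `p` followed by entries `q`. -/
def stepTuple (m : ℕ) (h : p ⩿ q) (l : ℕ) : MCover P m :=
  .mk (fun i => if (i : ℕ) < l then p else q) fun i j hij => by
    have : (i : ℕ) ≤ j := hij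
    right
    split_ifs
    · exact WCovBy.refl _
    · exact h
    · omega
    · exact WCovBy.refl _

theorem stepTuple_covBy (h : p ⋖ q) {l : ℕ} (hl : l < m) :
    stepTuple m h.wcovBy (l + 1) ⋖ stepTuple m h.wcovBy l := by
  have hval : ∀ i : Fin m, (i : ℕ) ≠ l →
      (stepTuple m h.wcovBy (l + 1)).1 i = (stepTuple m h.wcovBy l).1 i := by
    intro i hi
    simp only [stepTuple, MCover.mk]
    congr 1
    exact propext (by omega)
  have h1 : (stepTuple m h.wcovBy (l + 1)).1 ⟨l, hl⟩ = p := by simp [stepTuple, MCover.mk]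
  have h2 : (stepTuple m h.wcovBy l).1 ⟨l, hl⟩ = q := by simp [stepTuple, MCover.mk]
  refine covBy_of_eq_or_eq (lt_of_le_of_ne ?_ fun he => h.lt.ne ?_) fun w hw hw' => ?_
  · intro i
    by_cases hi : (i : ℕ) = l
    · obtain rfl : i = ⟨l, hl⟩ := Fin.ext hi
      exact h1.trans_le (h.le.trans h2.ge)
    · exact (hval i hi).le
  · exact h1.symm.trans ((congrArg (fun x => x.1 ⟨l, hl⟩) he).trans h2)
  · have hother : ∀ i : Fin m, (i : ℕ) ≠ l → w.1 i = (stepTuple m h.wcovBy l).1 i := fun i hi =>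
      le_antisymm (hw' i) ((hval i hi).ge.trans (hw i))
    rcases h.eq_or_eq (h1.ge.trans (hw ⟨l, hl⟩)) ((hw' ⟨l, hl⟩).trans h2.le) with h3 | h3
    · refine Or.inl (Subtype.ext (funext fun i => ?_))
      by_cases hi : (i : ℕ) = l
      · obtain rfl : i = ⟨l, hl⟩ := Fin.ext hi
        exact h3.trans h1.symm
      · exact (hother i hi).trans (hval i hi).symm
    · refine Or.inr (Subtype.ext (funext fun i => ?_))
      by_cases hi : (i : ℕ) = l
      · obtain rfl : i = ⟨l, hl⟩ := Fin.ext hi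
        exact h3.trans h2.symm
      · exact hother i hi

/-- A saturated chain of the `m`-cover poset raising one entry at a time. -/
theorem exists_isSaturatedChain_mCover (ha : IsAtom a) {k : ℕ} (hp : p = ⊥ ∨ a ≤ p) :
    ∃ c : List (MCover P (k + 1)),
      IsSaturatedChain (stepTuple (k + 1) (WCovBy.refl p) 0)
        (stepTuple (k + 1) (WCovBy.refl ⊤) 0) c ∧
      ∀ x ∈ c, (∀ i, x.1 i = ⊥ ∨ a ≤ x.1 i) ∧ ∀ i, x.1 i = ⊥ → x.1 (Fin.last k) ≤ a := by
  induction p using WellFoundedGT.induction with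
  | ind p ih =>
    rcases eq_or_ne p ⊤ with rfl | htop
    · refine ⟨_, .singleton _, fun x hx => ?_⟩
      obtain rfl := List.mem_singleton.1 hx
      simp only [stepTuple, MCover.mk, Nat.not_lt_zero, if_false]
      exact ⟨fun _ => hp, fun _ h => h.trans_le bot_le⟩
    -- The first step from `⊥` must go to `a`; afterwards any cover will do.
    obtain ⟨q, hpq, hq, hpa⟩ : ∃ q, p ⋖ q ∧ a ≤ q ∧ (p = ⊥ → q ≤ a) := by
      rcases hp with rfl | hp
      · exact ⟨a, ha.bot_covBy, le_rfl, fun _ => le_rfl⟩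
      · obtain ⟨q, hpq, -⟩ := exists_covBy_le_of_lt (lt_top_iff_ne_top.2 htop)
        exact ⟨q, hpq, hp.trans hpq.le,
          fun h => absurd (le_bot_iff.1 (hp.trans h.le)) ha.1⟩
    -- Entries are raised from `p` to `q` from right to left: `l = k + 1` is the constant tuple `p`,
    -- `l = 0` the constant tuple `q`.
    have hl : ∀ l ≤ k + 1, ∃ c : List (MCover P (k + 1)),
        IsSaturatedChain (stepTuple (k + 1) hpq.wcovBy l)
          (stepTuple (k + 1) (WCovBy.refl ⊤) 0) c ∧
        ∀ x ∈ c, (∀ i, x.1 i = ⊥ ∨ a ≤ x.1 i) ∧ ∀ i, x.1 i = ⊥ → x.1 (Fin.last k) ≤ a := by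
      intro l
      induction l with
      | zero => exact fun _ => ih q hpq.lt (Or.inr hq)
      | succ l ihl =>
        intro hlk
        obtain ⟨c, hc, hcx⟩ := ihl (by omega)
        refine ⟨_, hc.cons (stepTuple_covBy hpq (by omega)), ?_⟩
        intro x hx
        rcases List.mem_cons.1 hx with rfl | hx
        · simp only [stepTuple, MCover.mk]
          refine ⟨fun i => ?_, fun i hi => ?_⟩
          · split_ifs
            · exact hp
            · exact Or.inr hq
          · have hp0 : p = ⊥ := by
              split_ifs at hi
              · exact hi
              · exact absurd (le_bot_iff.1 (hq.trans hi.le)) ha.1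
            split_ifs
            · exact hp0.trans_le bot_le
            · exact hpa hp0
        · exact hcx x hx
    have hk : stepTuple (k + 1) hpq.wcovBy (k + 1) = stepTuple (k + 1) (WCovBy.refl p) 0 :=
      Subtype.ext (funext fun i => if_pos i.2)
    exact hk ▸ hl (k + 1) le_rfl

end Chain

theorem isLeftModularLattice_mCover {P : Type*} [Lattice P] [BoundedOrder P] [Finite P]
    [Nontrivial P] (hT : IsTreeLike P) {k : ℕ} (h : IsLatticePoset (MCover P (k + 1)))
    (hfree : IsTwoPlusTwoFree P) : IsLeftModularLattice (MCover P (k + 1)) := by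
  obtain ⟨a, ha⟩ := exists_isBaseAtom (hT.isTwoPlusTwoFree_iff.1 hfree)
  obtain ⟨c, hc, hcx⟩ := exists_isSaturatedChain_mCover ha.1 (k := k) (Or.inl rfl)
  refine ⟨h, _, _, c, fun x i => ?_, fun x i => ?_, hc,
    fun x hx => isLeftModularElem_mCover ha hT h (hcx x hx).1 (hcx x hx).2⟩
  · simp [stepTuple, MCover.mk]
  · simp [stepTuple, MCover.mk]

/-! ### Path posets -/

section Path

variable {w : NEPath}

theorem NEStep.eq_east_of_ne {s : NEStep} (h : s ≠ .north) : s = .east := by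
  cases s <;> simp_all

theorem NEPath.stepLE_of_north {i j : Fin w.length} (hi : w.get i = .north)
    (hj : w.get j = .north) (hij : i ≤ j) : w.StepLE i j := by
  induction j using WellFoundedLT.induction with
  | ind j ih =>
    rcases hij.eq_or_lt with rfl | hlt
    · exact .refl
    by_cases hs : ∀ s, i < s → s < j → w.get s ≠ .north
    · exact .single (.north hlt hi hj hs)
    · have hex : ∃ s, (i ≤ s ∧ s < j ∧ w.get s = .north) := ⟨i, le_rfl, hlt, hi⟩
      obtain ⟨s, hs⟩ := (Set.toFinite {s | i ≤ s ∧ s < j ∧ w.get s = .north}).exists_maximal hex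
      refine (ih s hs.1.2.1 hs.1.2.2 hs.1.1).tail (.north hs.1.2.1 hs.1.2.2 hj ?_)
      intro t hst htj ht
      exact hst.not_ge (hs.2 ⟨hs.1.1.trans hst.le, htj, ht⟩ hst.le)

theorem NEPath.blockStart_spec (w : NEPath) (n : ℕ) :
    w.blockStart n ≤ n ∧ (∀ s, w.blockStart n ≤ s → s < n → w[s]? = some .east) ∧
      ∀ b, w.blockStart n = b + 1 → w[b]? ≠ some .east := by
  induction n with
  | zero => simp [NEPath.blockStart]
  | succ n ih =>
    rw [NEPath.blockStart]
    split
    · rename_i h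
      refine ⟨ih.1.trans n.le_succ, fun s hs hsn => ?_, ih.2.2⟩
      rcases Nat.lt_succ_iff_lt_or_eq.1 hsn with h' | rfl
      · exact ih.2.1 s hs h'
      · exact h
    · rename_i h
      refine ⟨le_rfl, fun s hs hsn => by omega, fun b hb => ?_⟩
      obtain rfl : n = b := by omega
      exact h

/-- The path order, explicitly. -/
theorem NEPath.stepLE_iff {i j : Fin w.length} : w.StepLE i j ↔ i = j ∨ (w.get j = .north ∧
    ((w.get i = .north ∧ i < j) ∨ (w.get i = .east ∧ (∃ s < i, w.get s = .north) ∧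
      ∀ s < i, w.get s = .north → s ≤ j))) := by
  have get? : ∀ s : Fin w.length, w[(s : ℕ)]? = some (w.get s) := fun s => by simp
  constructor
  · intro h
    unfold NEPath.StepLE at h
    induction h with
    | refl => exact Or.inl rfl
    | tail _ hc ih =>
      right
      rcases ih with rfl | ⟨hk, ih⟩
      · cases hc with
        | north hij hi hj _ => exact ⟨hj, Or.inl ⟨hi, hij⟩⟩
        | east hj hi hb =>
          obtain ⟨h1, h2, -⟩ := w.blockStart_spec i
          refine ⟨hi, Or.inr ⟨hj, ⟨_, ?_, hi⟩, fun s hs hsN => ?_⟩⟩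
          · exact Fin.lt_def.2 (by omega)
          · by_contra hlt
            have := h2 s (by rw [hb]; exact Nat.succ_le_of_lt (not_le.1 hlt)) hs
            rw [get?, hsN] at this
            simp at this
      · cases hc with
        | north hij _ hj _ =>
          refine ⟨hj, ih.imp (fun h => ⟨h.1, h.2.trans hij⟩) fun h => ⟨h.1, h.2.1, fun s hs hsN => ?_⟩⟩
          exact (h.2.2 s hs hsN).trans hij.le
        | east hj _ _ => rw [hk] at hj; cases hj
  · rintro (rfl | ⟨hj, ⟨hi, hij⟩ | ⟨hi, ⟨s, hs, hsN⟩, hall⟩⟩)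
    · exact .refl
    · exact NEPath.stepLE_of_north hi hj hij.le
    · obtain ⟨h1, h2, h3⟩ := w.blockStart_spec i
      obtain ⟨b, hb⟩ : ∃ b, w.blockStart i = b + 1 := by
        refine Nat.exists_eq_succ_of_ne_zero fun h0 => ?_
        have := h2 s (by omega) hs
        rw [get?, hsN] at this
        simp at this
      have hbi : b < i := by omega
      let t : Fin w.length := ⟨b, hbi.trans i.2⟩
      have ht : w.get t = .north := by
        by_contra h
        exact h3 b hb ((get? t).trans (congrArg some (NEStep.eq_east_of_ne h)))
      exact .head (.east hi ht hb) (NEPath.stepLE_of_north ht hj (hall t hbi ht))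

/-- An element strictly above a non-least one is the top of the base, a member of its `k`-chain, or
a letter `N`. These form a chain, so the upper elements of a `2+2` would be comparable. -/
theorem isTwoPlusTwoFree_pathPoset (k l : ℕ) (w : NEPath) :
    IsTwoPlusTwoFree (PathPoset (ChainAntichain k l) w) := by
  have bot_le' : ∀ z : PathPoset (ChainAntichain k l) w, .base ⊥ ≤ z := by
    rintro (q | j)
    · exact (bot_le : (⊥ : ChainAntichain k l) ≤ q)
    · cases h : w.get j
      · exact Or.inr h
      · exact Or.inl ⟨rfl, h⟩
  have upper : ∀ x y : PathPoset (ChainAntichain k l) w, x ≠ .base ⊥ → x < y →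
      y = .base ⊤ ∨ (∃ i : Fin k, y = .base ((.inl i : Fin k ⊕ AntichainPoset l) :)) ∨
        ∃ j, y = .step j ∧ w.get j = .north := by
    rintro x (q | j) hx hxy
    · rcases x with p | i
      · have hp : p ≠ ⊥ := fun h => hx (by rw [h])
        have hpq : p ≤ q := hxy.le
        have hne : p ≠ q := fun h => hxy.ne (by rw [h])
        induction q using WithBot.recBotCoe with
        | bot => exact absurd (le_bot_iff.1 hpq) hp
        | coe q =>
          induction q using WithTop.recTopCoe with
          | top => exact Or.inl rfl
          | coe q =>
            rcases q with q | q
            · exact Or.inr (Or.inl ⟨q, rfl⟩)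
            · exfalso
              induction p using WithBot.recBotCoe with
              | bot => exact hp rfl
              | coe p =>
                induction p using WithTop.recTopCoe with
                | top => simp at hpq
                | coe p =>
                  rw [WithBot.coe_le_coe, WithTop.coe_le_coe] at hpq
                  rcases p with p | p
                  · simp at hpq
                  · rw [Sum.inr_le_inr_iff] at hpq
                    exact hne (by rw [show p = q from hpq])
      · exact (hxy.le : False).elim
    · right; right
      refine ⟨j, rfl, ?_⟩
      rcases x with p | i
      · rcases (hxy.le : (p = ⊥ ∧ w.get j = .east) ∨ w.get j = .north) with h | h
        · exact absurd (by rw [h.1]) hx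
        · exact h
      · exact ((hxy.le : w.StepLE i j).north).resolve_left fun h => hxy.ne (by rw [h])
  rintro ⟨x, y, x', y', hxy, hxy', h1, h2⟩
  have hx : x ≠ .base ⊥ := fun h => h1.1 (h ▸ bot_le' _)
  have hx' : x' ≠ .base ⊥ := fun h => h2.1 (h ▸ bot_le' _)
  have hn : ∀ (p : ChainAntichain k l) (j : Fin w.length), w.get j = .north →
      (PathPoset.base p : PathPoset (ChainAntichain k l) w) ≤ .step j := fun p j h => Or.inr h
  have hb : ∀ p q : ChainAntichain k l, p ≤ q →
      (PathPoset.base p : PathPoset (ChainAntichain k l) w) ≤ .base q := fun p q h => h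
  have hs : ∀ i j : Fin w.length, w.StepLE i j →
      (PathPoset.step i : PathPoset (ChainAntichain k l) w) ≤ .step j := fun i j h => h
  suffices y ≤ y' ∨ y' ≤ y from this.elim h1.2.2.2 h2.2.2.2
  rcases upper x y hx hxy with rfl | ⟨i, rfl⟩ | ⟨j, rfl, hj⟩ <;>
    rcases upper x' y' hx' hxy' with rfl | ⟨i', rfl⟩ | ⟨j', rfl, hj'⟩
  · exact Or.inl le_rfl
  · exact Or.inr (hb _ _ le_top)
  · exact Or.inl (hn _ _ hj')
  · exact Or.inl (hb _ _ le_top)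
  · refine (le_total i i').imp (fun h => hb _ _ ?_) (fun h => hb _ _ ?_) <;>
      simpa using h
  · exact Or.inl (hn _ _ hj')
  · exact Or.inr (hn _ _ hj)
  · exact Or.inr (hn _ _ hj)
  · exact (le_total j j').imp (fun h => hs _ _ (NEPath.stepLE_of_north hj hj' h))
      (fun h => hs _ _ (NEPath.stepLE_of_north hj' hj h))

theorem IsTwoPlusTwoFree.of_orderIso {P Q : Type*} [PartialOrder P] [PartialOrder Q] (e : P ≃o Q)
    (h : IsTwoPlusTwoFree Q) : IsTwoPlusTwoFree P := by
  rintro ⟨x, y, x', y', hxy, hxy', h1, h2⟩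
  exact h ⟨e x, e y, e x', e y', e.lt_iff_lt.2 hxy, e.lt_iff_lt.2 hxy',
    by simpa only [e.le_iff_le] using h1, by simpa only [e.le_iff_le] using h2⟩

end Path

/-! ### Recognition of path posets -/

section Recognition

variable {P : Type*} [PartialOrder P] [BoundedOrder P]

theorem IsBaseAtom.isHigh_iff {a x : P} (ha : IsBaseAtom a) (hne : x ≠ a) : IsHigh x ↔ a ≤ x :=
  ⟨ha.2 x, fun h => ⟨a, ha.1.1, h.lt_of_ne' hne⟩⟩

variable [Finite P]

/-- The number of high elements that are not above `x`. -/
noncomputable def numHighNotGE (x : P) : ℕ := {c : P | IsHigh c ∧ ¬ x ≤ c}.ncard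

open Classical in
/-- A key by which the letters of the path are sorted. -/
noncomputable def pathKey (x : P) : ℕ := 2 * numHighNotGE x + if IsHigh x then 0 else 1

theorem numHighNotGE_le {x y : P} (h : ∀ c, IsHigh c → y ≤ c → x ≤ c) :
    numHighNotGE x ≤ numHighNotGE y :=
  Set.ncard_le_ncard (fun c hc => ⟨hc.1, fun h' => hc.2 (h c hc.1 h')⟩) (Set.toFinite _)

theorem numHighNotGE_lt {x y c : P} (hc : IsHigh c) (hxc : x ≤ c) (hcy : c < y) :
    numHighNotGE x < numHighNotGE y :=
  Set.ncard_lt_ncard ⟨fun _ hd => ⟨hd.1, fun h => hd.2 (hxc.trans (hcy.le.trans h))⟩,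
    fun h => (h (show c ∈ _ from ⟨hc, hcy.not_ge⟩)).2 hxc⟩ (Set.toFinite _)

/-- Doubling makes a strict increase of the count outweigh the summand `1`, which only places an
atom after a high element with equal count. -/
theorem pathKey_lt {x y c : P} (hc : IsHigh c) (hxc : x ≤ c) (hcy : c < y) :
    pathKey x < pathKey y := by
  have := numHighNotGE_lt hc hxc hcy
  unfold pathKey
  split_ifs <;> omega

/-- Sort by the key and write `N` for high elements, `E` for the others; the order among equal keys
is immaterial. -/
theorem exists_path_enumeration (S : Set P) :
    ∃ (w : NEPath) (φ : Fin w.length → P), Function.Injective φ ∧ Set.range φ = S ∧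
      (∀ i, w.get i = .north ↔ IsHigh (φ i)) ∧ ∀ i j, pathKey (φ i) < pathKey (φ j) → i < j := by
  classical
  obtain ⟨n, ⟨e⟩⟩ := Finite.exists_equiv_fin S
  let g : Fin n → ℕ := fun i => pathKey (e.symm i : P)
  let ψ : Fin n → P := fun i => (e.symm (Tuple.sort g i) : P)
  have hψ : Function.Injective ψ :=
    Subtype.val_injective.comp (e.symm.injective.comp (Tuple.sort g).injective)
  have hmono : Monotone fun i => pathKey (ψ i) := Tuple.monotone_sort g
  let w : NEPath := List.ofFn fun i => if IsHigh (ψ i) then NEStep.north else NEStep.east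
  have hw : w.length = n := by simp [w]
  refine ⟨w, fun i => ψ (i.cast hw), fun i j h => Fin.cast_injective hw (hψ h), ?_, ?_, ?_⟩
  · ext x
    constructor
    · rintro ⟨i, rfl⟩
      exact (e.symm _).2
    · intro hx
      exact ⟨((Tuple.sort g).symm (e ⟨x, hx⟩)).cast hw.symm, by simp [ψ]⟩
  · intro i
    have : w.get i = if IsHigh (ψ (i.cast hw)) then NEStep.north else NEStep.east := by
      simp only [w, List.get_ofFn]
    rw [this]
    split_ifs with h <;> simp [h]
  · intro i j h
    by_contra hle
    exact (hmono (show j.cast hw ≤ i.cast hw from not_lt.1 hle)).not_gt h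

theorem nonempty_orderIso_pathPoset [Nontrivial P]
    (h : ∀ y y' : P, IsHigh y → IsHigh y' → y ≤ y' ∨ y' ≤ y) :
    ∃ w : NEPath, Nonempty (P ≃o PathPoset (ChainAntichain 0 0) w) := by
  classical
  obtain ⟨a, ha⟩ := exists_isBaseAtom h
  obtain ⟨w, φ, hinj, hrange, hN, hkey⟩ := exists_path_enumeration {x : P | x ≠ ⊥ ∧ x ≠ a}
  have hφ : ∀ i, φ i ≠ ⊥ ∧ φ i ≠ a := fun i => hrange.le ⟨i, rfl⟩
  have hE : ∀ i, w.get i = .east ↔ ¬ IsHigh (φ i) := fun i => by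
    rw [← hN]
    cases w.get i <;> simp
  have hex : ∀ x, x ≠ ⊥ → x ≠ a → ∃ i, φ i = x := fun x h0 h1 => hrange.ge ⟨h0, h1⟩
  have hhigh : ∀ i j, IsHigh (φ i) → IsHigh (φ j) → (i ≤ j ↔ φ i ≤ φ j) := by
    intro i j hi hj
    constructor
    · intro hij
      rcases h _ _ hi hj with h' | h'
      · exact h'
      · rcases h'.eq_or_lt with h' | h'
        · exact h'.ge
        · exact absurd (hkey _ _ (pathKey_lt hj le_rfl h')) hij.not_gt
    · intro h'
      rcases h'.eq_or_lt with h' | h'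
      · exact (hinj h').le
      · exact (hkey _ _ (pathKey_lt hi le_rfl h')).le
  have hstep : ∀ i j, φ i ≤ φ j ↔ w.StepLE i j := by
    intro i j
    rw [NEPath.stepLE_iff]
    by_cases hij : i = j
    · simp [hij]
    have hne : φ i ≠ φ j := fun h' => hij (hinj h')
    simp only [hij, false_or, hN, hE]
    by_cases hj : IsHigh (φ j)
    swap
    · simp only [hj, false_and, iff_false]
      exact fun h' => hj ⟨_, (hφ i).1, h'.lt_of_ne hne⟩
    by_cases hi : IsHigh (φ i)
    · simp only [hi, hj, true_and, not_true_eq_false, false_and, or_false, ← hhigh i j hi hj]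
      exact ⟨fun h' => h'.lt_of_ne hij, le_of_lt⟩
    simp only [hi, hj, true_and, not_false_eq_true, false_and, false_or]
    have htop : IsHigh (⊤ : P) := hj.mono le_top
    -- The least high element above the atom `φ i`; its key is smaller, so its letter `N` precedes
    -- the letter `E` of `φ i`.
    obtain ⟨r, hr⟩ := (Set.toFinite {r : P | IsHigh r ∧ φ i ≤ r}).exists_minimal ⟨⊤, htop, le_top⟩
    have hrmin : ∀ c, IsHigh c → φ i ≤ c → r ≤ c := fun c hc hic =>
      (h r c hr.1.1 hc).elim id fun h' => hr.2 ⟨hc, hic⟩ h'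
    have hra : r ≠ a := fun h' => by
      obtain ⟨x, hx, hxr⟩ := hr.1.1
      exact hx (ha.1.2 x (h' ▸ hxr))
    obtain ⟨s, rfl⟩ := hex r hr.1.1.ne_bot hra
    have hsi : s < i := hkey _ _ (by
      have := numHighNotGE_le hrmin
      simp only [pathKey, if_pos hr.1.1, if_neg hi]
      omega)
    constructor
    · refine fun hle => ⟨⟨s, hsi, hr.1.1⟩, fun t ht htN => ?_⟩
      rw [hhigh t j htN hj]
      rcases h _ _ htN hj with h' | h'
      · exact h'
      · rcases h'.eq_or_lt with h' | h'
        · exact h'.ge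
        · exact absurd (hkey _ _ (pathKey_lt hj hle h')) ht.not_gt
    · exact fun h' => hr.1.2.trans ((hhigh s j hr.1.1 hj).1 (h'.2 s hsi hr.1.1))
  have hbase : ∀ p : ChainAntichain 0 0, p = ⊥ ∨ p = ⊤ := by
    intro p
    induction p using WithBot.recBotCoe with
    | bot => exact Or.inl rfl
    | coe p =>
      induction p using WithTop.recTopCoe with
      | top => exact Or.inr rfl
      | coe p =>
        rcases p with p | p
        · exact p.elim0
        · exact p.idx.elim0
  have htb : (⊤ : ChainAntichain 0 0) ≠ ⊥ := top_ne_bot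
  -- The two base elements go to `⊥` and `a`, the letters to all other elements.
  let F : PathPoset (ChainAntichain 0 0) w → P
    | .base p => if p = ⊥ then ⊥ else a
    | .step j => φ j
  have hF0 : F (.base ⊥) = ⊥ := if_pos rfl
  have hF1 : F (.base ⊤) = a := if_neg htb
  have hle : ∀ x y, F x ≤ F y ↔ x ≤ y := by
    rintro (p | i) (q | j)
    · change _ ↔ p ≤ q
      rcases hbase p with rfl | rfl <;> rcases hbase q with rfl | rfl
      · simp
      · simp [hF0]
      · simp [hF0, hF1, ha.1.1, htb]
      · simp
    · change _ ↔ (p = ⊥ ∧ w.get j = .east) ∨ w.get j = .north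
      rw [hN, hE]
      rcases hbase p with rfl | rfl
      · rw [hF0]
        exact iff_of_true bot_le (by tauto)
      · rw [hF1]
        simp only [htb, false_and, false_or]
        exact (ha.isHigh_iff (hφ j).2).symm
    · refine iff_of_false (fun h' => ?_) (fun h' => h')
      have hqa : F (.base q) ≤ a := by
        rcases hbase q with rfl | rfl
        · exact hF0.trans_le bot_le
        · exact hF1.le
      exact (ha.1.le_iff.1 (h'.trans hqa)).elim (hφ i).1 (hφ i).2
    · exact hstep i j
  have hsurj : Function.Surjective F := by
    intro x
    by_cases h0 : x = ⊥
    · exact ⟨.base ⊥, hF0.trans h0.symm⟩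
    by_cases h1 : x = a
    · exact ⟨.base ⊤, hF1.trans h1.symm⟩
    obtain ⟨i, hi⟩ := hex x h0 h1
    exact ⟨.step i, hi⟩
  exact ⟨w, ⟨(RelIso.ofSurjective (OrderEmbedding.ofMapLEIff F hle) hsurj).symm⟩⟩

end Recognition

end CoverPoset

/-! ### The equivalences -/

theorem theorem1p2 (P : Type*) [PartialOrder P] [BoundedOrder P] [Finite P]
    (hP : ∀ m : ℕ, 0 < m → CoverPoset.IsLatticePoset (CoverPoset.MCover P m))
    (m : ℕ) (hm : 0 < m) :
    List.TFAE [
      (Nat.card P = 1 ∨ ∃ (k l : ℕ) (w : CoverPoset.NEPath),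
        Nonempty (P ≃o CoverPoset.PathPoset (CoverPoset.ChainAntichain k l) w)),
      CoverPoset.IsTwoPlusTwoFree P,
      CoverPoset.IsLeftModularLattice (CoverPoset.MCover P m),
      CoverPoset.IsELShellable (CoverPoset.MCover P m)] := by
  open CoverPoset in
  obtain ⟨k, rfl⟩ := Nat.exists_eq_succ_of_ne_zero hm.ne'
  have hT : IsTreeLike P := fun _ _ _ => eq_of_covBy_of_mCover_two (hP 2 two_pos)
  tfae_have 1 → 2 := by
    rintro (h | ⟨k, l, w, ⟨e⟩⟩)
    · have := (Nat.card_eq_one_iff_unique.1 h).1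
      rintro ⟨x, y, -, -, hxy, -⟩
      exact hxy.ne (Subsingleton.elim x y)
    · exact (isTwoPlusTwoFree_pathPoset k l w).of_orderIso e
  tfae_have 2 → 1 := by
    intro h
    rcases subsingleton_or_nontrivial P with hs | hs
    · exact Or.inl (Nat.card_eq_one_iff_unique.2 ⟨hs, ⟨⊥⟩⟩)
    · obtain ⟨w, hw⟩ := nonempty_orderIso_pathPoset (hT.isTwoPlusTwoFree_iff.1 h)
      exact Or.inr ⟨0, 0, w, hw⟩
  tfae_have 2 → 3 := by
    intro h
    rcases subsingleton_or_nontrivial P with hs | hs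
    · refine ⟨hP _ hm, ⟨⊥, Or.inl rfl⟩, ⟨⊥, Or.inl rfl⟩, [⟨⊥, Or.inl rfl⟩],
        fun x => (Subsingleton.elim _ _).le, fun x => (Subsingleton.elim _ _).le,
        .singleton _, fun p _ q q' hq => ?_⟩
      exact absurd (Subsingleton.elim q q') hq.ne
    · let := (isLatticePoset_of_mCover (hP _ hm)).toLattice
      exact isLeftModularLattice_mCover hT (hP _ hm) h
  tfae_have 3 → 4 := IsLeftModularLattice.isELShellable
  tfae_have 4 → 2 := isTwoPlusTwoFree_of_isELShellable_mCover hT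
  tfae_finish
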